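/- Let $\mathfrak X$ be a countably infinite alphabet containing the distinct letters $x,z_1,t_1,z_2,t_2,\dots$, and let words be the elements of the free monoid $\mathfrak X^*$. For a word $\mathbf w$, the factor monoid $M(\mathbf w)$ consists of all factors of $\mathbf w$ together with a zero element $0$; the product of two factors $\mathbf u,\mathbf v$ of $\mathbf w$ is $\mathbf u\mathbf v$ if $\mathbf u\mathbf v$ is a factor of $\mathbf w$, and all other products are $0$. Let $\mathbf M(\mathbf w)$ be the variety of monoids generated by $M(\mathbf w)$. For $n,m\ge 0$ and a permutation $\rho$ of $\{1,\dots,n+m\}$ put $$\mathbf a_{n,m}[\rho]=\Bigl(\prod_{i=1}^{n}z_it_i\Bigr)\,x\,\Bigl(\prod_{i=1}^{n+m}z_{\rho(i)}\Bigr)\,x\,\Bigl(\prod_{i=n+1}^{n+m}t_iz_i\Bigr).$$ Call $\rho$ an $(n,m)$-permutation if, for every $1\le i\le n+m-1$, exactly one of $\rho(i),\rho(i+1)$ is at most $n$. **Proposition.** Let $n,m\ge 0$ be integers with $|n-m|\le 1$ and $(n,m)\ne(0,0)$, and let $\rho$ be an $(n,m)$-permutation. Then the lattice of subvarieties of $\mathbf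 M(\mathbf a_{n,m}[\rho])$, ordered by inclusion, is not distributive. -/

import Mathlib

/-- The countably infinite alphabet, with its letters named `x`, `z₀, z₁, …` and `t₀, t₁, …`. -/
inductive Letter : Type
  | x : Letter
  | z : ℕ → Letter
  | t : ℕ → Letter

/-- Words: elements of the free monoid over the alphabet. -/
abbrev Word : Type := FreeMonoid Letter

/-- The monoid `M` satisfies the identity `u ≈ v`. -/
def SatisfiesIdentity (M : MonCat.{0}) (u v : Word) : Prop :=
  ∀ φ : Letter → M, FreeMonoid.lift φ u = FreeMonoid.lift φ v

/-- The class of all monoids that satisfy every identity of the set `E`. -/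
def modelsOf (E : Set (Word × Word)) : Set MonCat.{0} :=
  {M | ∀ e ∈ E, SatisfiesIdentity M e.1 e.2}

/-- A variety of monoids: a class of monoids that is given by a set of identities. -/
@[ext]
structure MonoidVariety where
  carrier : Set MonCat.{0}
  equational : ∃ E : Set (Word × Word), carrier = modelsOf E

namespace MonoidVariety

/-- Varieties are ordered by inclusion. -/
instance : PartialOrder MonoidVariety :=
  PartialOrder.lift carrier (fun _ _ h => MonoidVariety.ext h)

/-- The meet of a family of varieties is its intersection. -/
instance : InfSet MonoidVariety where
  sInf S :=
    { carrier := {M | ∀ V ∈ S, M ∈ V.carrier}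
      equational := by
        refine ⟨{e | ∃ V ∈ S, ∃ E, V.carrier = modelsOf E ∧ e ∈ E}, ?_⟩
        ext M
        constructor
        · rintro hM e ⟨V, hV, E, hE, he⟩
          have h := hM V hV
          rw [hE] at h
          exact h e he
        · intro hM V hV
          obtain ⟨E, hE⟩ := V.equational
          rw [hE]
          exact fun e he => hM e ⟨V, hV, E, hE, he⟩ }

/-- The lattice of all varieties of monoids under inclusion: the meet is the intersection, and the
join is the smallest variety that contains the given ones. -/
instance : CompleteLattice MonoidVariety :=
  completeLatticeOfInf MonoidVariety (fun _ =>
    ⟨fun V hV _ hM => hM V hV, fun _ hU _ hM _ hV => hU hV hM⟩)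

/-- The variety generated by a monoid: the smallest variety that contains it. -/
def generatedBy (M : MonCat.{0}) : MonoidVariety :=
  sInf {V | M ∈ V.carrier}

/-- The lattice of subvarieties of `V`. -/
abbrev SubvarietyLattice (V : MonoidVariety) : Type 1 := Set.Iic V

end MonoidVariety

/-- The lattice `L` is distributive. -/
def IsDistributiveLattice (L : Type*) [Lattice L] : Prop :=
  ∀ a b c : L, (a ⊔ b) ⊓ c = (a ⊓ c) ⊔ (b ⊓ c)

/-- The word `u` is a factor of some word of `W`. -/
def IsFactorOf (W : Set Word) (u : Word) : Prop :=
  ∃ w ∈ W, ∃ a b : Word, w = a * u * b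

/-- The underlying set of the factor monoid `M(W)`: the factors of the words of `W`, and a further
element `none`, the zero. -/
def FactorMonoid (W : Set Word) : Type := Option {u : Word // IsFactorOf W u}

namespace FactorMonoid

variable {W : Set Word}

/-- The word `u` as an element of `M(W)`: itself if it is a factor of a word of `W`, and the zero
otherwise. -/
noncomputable def ofWord (W : Set Word) (u : Word) : FactorMonoid W :=
  open scoped Classical in if h : IsFactorOf W u then some ⟨u, h⟩ else none

/-- `u · v = uv` if `uv` is a factor of a word of `W`, and all other products are zero. -/
noncomputable def mul : FactorMonoid W → FactorMonoid W → FactorMonoid W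
  | some u, some v => ofWord W (u.1 * v.1)
  | _, _ => none

theorem ofWord_of_isFactorOf {u : Word} (h : IsFactorOf W u) :
    ofWord W u = some ⟨u, h⟩ := dif_pos h

theorem ofWord_of_not {u : Word} (h : ¬ IsFactorOf W u) : ofWord W u = none := dif_neg h

theorem isFactorOf_left {u v : Word} (h : IsFactorOf W (u * v)) : IsFactorOf W u := by
  obtain ⟨w, hw, a, b, rfl⟩ := h
  exact ⟨_, hw, a, v * b, by simp only [mul_assoc]⟩

theorem isFactorOf_right {u v : Word} (h : IsFactorOf W (u * v)) : IsFactorOf W v := by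
  obtain ⟨w, hw, a, b, rfl⟩ := h
  exact ⟨_, hw, a * u, b, by simp only [mul_assoc]⟩

theorem mul_ofWord (u v : Word) : mul (ofWord W u) (ofWord W v) = ofWord W (u * v) := by
  by_cases hu : IsFactorOf W u
  · by_cases hv : IsFactorOf W v
    · rw [ofWord_of_isFactorOf hu, ofWord_of_isFactorOf hv]; rfl
    · rw [ofWord_of_not hv, ofWord_of_not (fun h => hv (isFactorOf_right h)),
        ofWord_of_isFactorOf hu]; rfl
  · rw [ofWord_of_not hu, ofWord_of_not (fun h => hu (isFactorOf_left h))]; rfl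

theorem eq_none_or_ofWord (a : FactorMonoid W) : a = none ∨ ∃ u, a = ofWord W u := by
  rcases a with _ | ⟨u, hu⟩
  · exact Or.inl rfl
  · exact Or.inr ⟨u, (ofWord_of_isFactorOf hu).symm⟩

theorem none_mul (a : FactorMonoid W) : mul none a = none := rfl

theorem mul_none (a : FactorMonoid W) : mul a none = none := by
  rcases a with _ | _ <;> rfl

noncomputable instance : Monoid (FactorMonoid W) where
  mul := mul
  one := ofWord W 1
  one_mul a := by
    change mul (ofWord W 1) a = a
    rcases eq_none_or_ofWord a with rfl | ⟨u, rfl⟩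
    · exact mul_none _
    · rw [mul_ofWord, one_mul]
  mul_one a := by
    change mul a (ofWord W 1) = a
    rcases eq_none_or_ofWord a with rfl | ⟨u, rfl⟩
    · rfl
    · rw [mul_ofWord, mul_one]
  mul_assoc a b c := by
    change mul (mul a b) c = mul a (mul b c)
    rcases eq_none_or_ofWord a with rfl | ⟨u, rfl⟩
    · rfl
    · rcases eq_none_or_ofWord b with rfl | ⟨v, rfl⟩
      · rw [none_mul, mul_none, none_mul]
      · rcases eq_none_or_ofWord c with rfl | ⟨w, rfl⟩
        · rw [mul_none, mul_none, mul_none]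
        · simp only [mul_ofWord, mul_assoc]

end FactorMonoid

/-- The word
`a_{n,m}[ρ] = (∏_{i=1}^{n} z_i t_i) x (∏_{i=1}^{n+m} z_{ρ(i)}) x (∏_{i=n+1}^{n+m} t_i z_i)`,
with all indices shifted by one, so that they start at `0`. -/
def aWord (n m : ℕ) (ρ : Equiv.Perm (Fin (n + m))) : Word :=
  (List.ofFn fun i : Fin n => FreeMonoid.of (Letter.z i) * FreeMonoid.of (Letter.t i)).prod
    * FreeMonoid.of Letter.x
    * (List.ofFn fun i : Fin (n + m) => FreeMonoid.of (Letter.z (ρ i))).prod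
    * FreeMonoid.of Letter.x
    * (List.ofFn fun j : Fin m =>
        FreeMonoid.of (Letter.t (n + j)) * FreeMonoid.of (Letter.z (n + j))).prod

/-- `(n,m)`-permutations: of any two consecutive values, exactly one is among the first `n`
indices (which are `0, …, n - 1` here). -/
def IsNMPermutation (n m : ℕ) (ρ : Equiv.Perm (Fin (n + m))) : Prop :=
  ∀ i j : Fin (n + m), (j : ℕ) = i + 1 →
    ((ρ i : ℕ) < n ∧ n ≤ (ρ j : ℕ)) ∨ ((ρ j : ℕ) < n ∧ n ≤ (ρ i : ℕ))

/-!
Extend the main block of `w = a_{n,m}[ρ]` by new letters at both ends, and let `f` be the resulting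
word, with main block `x P Z Q x`. Let `L₁` consist of the words obtained from `f` by moving the
first `x` inside `P`, and `L₂` of those obtained by moving the second `x` inside `Q`; let `g` and
`h` be the extreme cases, with main blocks `P x Z Q x` and `x P Z x Q`.

* Both languages are closed under the identities of `M(w)`, so that their syntactic monoids generate
  subvarieties `V₁` and `V₂` of the variety of `M(w)`. Indeed, the sides of the frame alternate in
  the main block, so that an identity of `M(w)` can only move the letter `x`. It cannot move `x`
  across a letter of `f` that survives an erasing substitution of `f` to a copy of `w`.
* Since `L₁ ∩ L₂ = {f}`, the monoid `M(f)` lies in `V₁ ∨ V₂`.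
* `V₁` satisfies `f ≈ g` and `V₂` satisfies `f ≈ h`, because the new letters are chosen in such a
  way that no substitution shifts the main block of `f`.
* `M(f)` satisfies `g ≈ f₀ ≈ h`, where `f₀` has both letters `x` at its very beginning, but it does
  not satisfy `f ≈ f₀`. Hence the variety of `M(f)` meets `V₁` and `V₂` in varieties that satisfy
  `f ≈ f₀`, and so does the join of these meets: the distributive law fails.
-/

/-! ### Identities of factor monoids and of syntactic monoids -/

/-- `u ≈ v` is an identity of the factor monoid of `w`, expressed through words: every substitution
that sends `u` or `v` to a factor of `w` identifies them. -/
def IsIdentityOf (w u v : List Letter) : Prop :=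
  ∀ φ : Letter → List Letter,
    (u.flatMap φ <:+: w ∨ v.flatMap φ <:+: w) → u.flatMap φ = v.flatMap φ

/-- `u ≈ v` is an identity of the syntactic monoid of the language `L`, expressed through words. -/
def IsSyntacticIdentityOf (L : Set (List Letter)) (u v : List Letter) : Prop :=
  ∀ (φ : Letter → List Letter) (p q : List Letter),
    p ++ u.flatMap φ ++ q ∈ L ↔ p ++ v.flatMap φ ++ q ∈ L

/-- The language `L` is a union of classes of the relatively free monoid of the variety generated by
the factor monoid of `w`. -/
def IsClosedUnderIdentitiesOf (w : List Letter) (L : Set (List Letter)) : Prop :=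
  ∀ u v, u ∈ L → IsIdentityOf w u v → v ∈ L

theorem IsIdentityOf.symm {w u v : List Letter} (h : IsIdentityOf w u v) : IsIdentityOf w v u :=
  fun φ hφ => (h φ hφ.symm).symm

theorem IsIdentityOf.eq_of_isInfix {w u v : List Letter} (h : IsIdentityOf w u v) (hu : u <:+: w) :
    u = v := by
  simpa using h (fun l => [l]) (Or.inl (by simpa using hu))

theorem IsIdentityOf.flatMap {w u v : List Letter} (h : IsIdentityOf w u v)
    (φ : Letter → List Letter) : IsIdentityOf w (u.flatMap φ) (v.flatMap φ) := fun ψ hψ => by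
  simp only [List.flatMap_assoc] at hψ ⊢
  exact h (fun l => (φ l).flatMap ψ) hψ

theorem IsIdentityOf.append {w u v : List Letter} (h : IsIdentityOf w u v) (p q : List Letter) :
    IsIdentityOf w (p ++ u ++ q) (p ++ v ++ q) := fun φ hφ => by
  simp only [List.flatMap_append] at hφ ⊢
  rw [h φ (hφ.imp (List.infix_append _ _ _).trans (List.infix_append _ _ _).trans)]

theorem IsClosedUnderIdentitiesOf.isSyntacticIdentityOf {w u v : List Letter}
    {L : Set (List Letter)} (hL : IsClosedUnderIdentitiesOf w L) (h : IsIdentityOf w u v) :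
    IsSyntacticIdentityOf L u v := fun φ p q =>
  ⟨fun hu => hL _ _ hu ((h.flatMap φ).append p q),
    fun hv => hL _ _ hv ((h.symm.flatMap φ).append p q)⟩

theorem toList_lift {α β : Type*} (φ : α → FreeMonoid β) (u : FreeMonoid α) :
    (FreeMonoid.lift φ u).toList = u.toList.flatMap fun l => (φ l).toList := by
  rw [FreeMonoid.lift_apply, FreeMonoid.toList_prod, List.map_map, List.flatMap]
  rfl

theorem satisfiesIdentity_iff_of_surjective {M : Type} [Monoid M] {π : Word →* M}
    (hπ : Function.Surjective π) {u v : Word} :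
    SatisfiesIdentity (MonCat.of M) u v ↔ ∀ φ : Letter → List Letter,
      π (FreeMonoid.ofList (u.toList.flatMap φ)) = π (FreeMonoid.ofList (v.toList.flatMap φ)) := by
  have key (φ : Letter → Word) (r : Word) : FreeMonoid.lift (π ∘ φ) r =
      π (FreeMonoid.ofList (r.toList.flatMap fun l => (φ l).toList)) := by
    rw [← toList_lift, FreeMonoid.ofList_toList, FreeMonoid.hom_map_lift]
  refine hπ.comp_left.forall.trans (forall_congr' fun φ => ?_)
  exact iff_of_eq (congrArg₂ (· = ·) (key φ u) (key φ v))

theorem isFactorOf_singleton {w u : Word} : IsFactorOf {w} u ↔ u.toList <:+: w.toList := by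
  constructor
  · rintro ⟨_, rfl, a, b, rfl⟩
    exact ⟨a.toList, b.toList, rfl⟩
  · rintro ⟨a, b, h⟩
    exact ⟨w, rfl, FreeMonoid.ofList a, FreeMonoid.ofList b, h.symm⟩

namespace FactorMonoid

theorem ofWord_eq_ofWord_iff {W : Set Word} {u v : Word} :
    ofWord W u = ofWord W v ↔ (IsFactorOf W u ∨ IsFactorOf W v → u = v) := by
  refine ⟨fun h => ?_, fun h => ?_⟩
  · by_cases hu : IsFactorOf W u <;> by_cases hv : IsFactorOf W v
    · rw [ofWord_of_isFactorOf hu, ofWord_of_isFactorOf hv] at h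
      exact fun _ => congrArg Subtype.val (Option.some.inj h)
    · rw [ofWord_of_isFactorOf hu, ofWord_of_not hv] at h
      exact absurd h (Option.some_ne_none _)
    · rw [ofWord_of_not hu, ofWord_of_isFactorOf hv] at h
      exact absurd h.symm (Option.some_ne_none _)
    · exact fun huv => (huv.elim hu hv).elim
  · by_cases huv : IsFactorOf W u ∨ IsFactorOf W v
    · rw [h huv]
    · rw [ofWord_of_not (fun hu => huv (Or.inl hu)), ofWord_of_not (fun hv => huv (Or.inr hv))]

/-- The canonical homomorphism from words to the factor monoid. -/
noncomputable def ofWordHom (W : Set Word) : Word →* FactorMonoid W where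
  toFun := ofWord W
  map_one' := rfl
  map_mul' u v := (mul_ofWord u v).symm

theorem ofWordHom_surjective (w : Word) : Function.Surjective (ofWordHom {w}) := by
  intro a
  rcases eq_none_or_ofWord a with rfl | ⟨u, rfl⟩
  · refine ⟨w * FreeMonoid.of Letter.x, ofWord_of_not fun h => ?_⟩
    have := (isFactorOf_singleton.1 h).length_le
    rw [FreeMonoid.toList_mul, List.length_append] at this
    exact Nat.not_succ_le_self _ this
  · exact ⟨u, rfl⟩

end FactorMonoid

theorem satisfiesIdentity_factorMonoid {w u v : Word} :
    SatisfiesIdentity (MonCat.of (FactorMonoid {w})) u v ↔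
      IsIdentityOf w.toList u.toList v.toList := by
  rw [satisfiesIdentity_iff_of_surjective (FactorMonoid.ofWordHom_surjective w)]
  refine forall_congr' fun φ => FactorMonoid.ofWord_eq_ofWord_iff.trans ?_
  rw [isFactorOf_singleton, isFactorOf_singleton, FreeMonoid.ofList.apply_eq_iff_eq]
  rfl

/-- The syntactic congruence of a subset of a monoid: the coarsest congruence that saturates it. -/
def syntacticCon {M : Type*} [Monoid M] (L : Set M) : Con M where
  r u v := ∀ p q, p * u * q ∈ L ↔ p * v * q ∈ L
  iseqv := ⟨fun _ _ _ => Iff.rfl, fun h p q => (h p q).symm,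
    fun h h' p q => (h p q).trans (h' p q)⟩
  mul' {a b c d} hab hcd p q := by
    have h_left := hab p (c * q)
    have h_right := hcd (p * b) q
    simp only [mul_assoc] at h_left h_right ⊢
    exact h_left.trans h_right

/-- The syntactic monoid of the language `L`. -/
abbrev syntacticMonoid (L : Set (List Letter)) : MonCat.{0} :=
  MonCat.of (syntacticCon (FreeMonoid.toList ⁻¹' L)).Quotient

theorem satisfiesIdentity_syntacticMonoid {L : Set (List Letter)} {u v : Word} :
    SatisfiesIdentity (syntacticMonoid L) u v ↔ IsSyntacticIdentityOf L u.toList v.toList := by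
  rw [satisfiesIdentity_iff_of_surjective (Con.mk'_surjective (c := syntacticCon _))]
  exact forall_congr' fun φ => Con.eq _

/-! ### A criterion for non-distributivity -/

theorem not_isDistributiveLattice_Iic {L : Type*} [Lattice L] {v a b c d : L} (ha : a ≤ v)
    (hb : b ≤ v) (hc : c ≤ a ⊔ b) (hac : a ⊓ c ≤ d) (hbc : b ⊓ c ≤ d) (hcd : ¬ c ≤ d) :
    ¬ IsDistributiveLattice (Set.Iic v) := fun hd => hcd <| by
  have h : (a ⊔ b) ⊓ c = (a ⊓ c) ⊔ (b ⊓ c) :=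
    congrArg Subtype.val (hd ⟨a, ha⟩ ⟨b, hb⟩ ⟨c, hc.trans (sup_le ha hb)⟩)
  calc c = (a ⊔ b) ⊓ c := (inf_eq_right.2 hc).symm
    _ = (a ⊓ c) ⊔ (b ⊓ c) := h
    _ ≤ d := sup_le hac hbc

namespace MonoidVariety

theorem self_mem_generatedBy (M : MonCat.{0}) : M ∈ (generatedBy M).carrier :=
  fun _ h => h

theorem generatedBy_le_iff {M : MonCat.{0}} {V : MonoidVariety} :
    generatedBy M ≤ V ↔ M ∈ V.carrier :=
  ⟨fun h => h (self_mem_generatedBy M), fun h _ hN => hN V h⟩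

theorem generatedBy_le_of_forall_satisfiesIdentity {M : MonCat.{0}} {V : MonoidVariety}
    (h : ∀ u v, (∀ N ∈ V.carrier, SatisfiesIdentity N u v) → SatisfiesIdentity M u v) :
    generatedBy M ≤ V := by
  obtain ⟨E, hE⟩ := V.equational
  rw [generatedBy_le_iff, hE]
  exact fun e he => h _ _ fun N hN => (hE ▸ hN : N ∈ modelsOf E) e he

/-- The variety defined by a single identity. -/
def ofIdentity (u v : List Letter) : MonoidVariety :=
  ⟨modelsOf {(FreeMonoid.ofList u, FreeMonoid.ofList v)}, _, rfl⟩

theorem mem_ofIdentity {M : MonCat.{0}} {u v : List Letter} : M ∈ (ofIdentity u v).carrier ↔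
    SatisfiesIdentity M (FreeMonoid.ofList u) (FreeMonoid.ofList v) :=
  ⟨fun h => h _ rfl, by rintro h _ rfl; exact h⟩

theorem inf_le_ofIdentity {A B : MonoidVariety} {u v r : List Letter} (hA : A ≤ ofIdentity u v)
    (hB : B ≤ ofIdentity v r) : A ⊓ B ≤ ofIdentity u r := fun _ hM =>
  mem_ofIdentity.2 fun φ =>
    (mem_ofIdentity.1 (hA (inf_le_left (b := B) hM)) φ).trans
      (mem_ofIdentity.1 (hB (inf_le_right (a := A) hM)) φ)

/-- The variety generated by the factor monoid of a word. -/
noncomputable def ofFactors (w : List Letter) : MonoidVariety :=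
  generatedBy (MonCat.of (FactorMonoid {FreeMonoid.ofList w}))

/-- The variety generated by the syntactic monoid of a language. -/
def ofLanguage (L : Set (List Letter)) : MonoidVariety := generatedBy (syntacticMonoid L)

theorem ofFactors_le_ofIdentity_iff {w u v : List Letter} :
    ofFactors w ≤ ofIdentity u v ↔ IsIdentityOf w u v :=
  generatedBy_le_iff.trans (mem_ofIdentity.trans satisfiesIdentity_factorMonoid)

theorem ofLanguage_le_ofIdentity_iff {L : Set (List Letter)} {u v : List Letter} :
    ofLanguage L ≤ ofIdentity u v ↔ IsSyntacticIdentityOf L u v :=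
  generatedBy_le_iff.trans (mem_ofIdentity.trans satisfiesIdentity_syntacticMonoid)

theorem ofLanguage_le_ofFactors {w : List Letter} {L : Set (List Letter)}
    (hL : IsClosedUnderIdentitiesOf w L) : ofLanguage L ≤ ofFactors w :=
  generatedBy_le_of_forall_satisfiesIdentity fun _ _ huv =>
    satisfiesIdentity_syntacticMonoid.2 (hL.isSyntacticIdentityOf
      (satisfiesIdentity_factorMonoid.1 (huv _ (self_mem_generatedBy _))))

theorem ofFactors_le_sup_ofLanguage {f : List Letter} {L₁ L₂ : Set (List Letter)}
    (h : L₁ ∩ L₂ = {f}) : ofFactors f ≤ ofLanguage L₁ ⊔ ofLanguage L₂ := by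
  refine generatedBy_le_of_forall_satisfiesIdentity fun u v huv =>
    satisfiesIdentity_factorMonoid.2 fun φ => ?_
  have h₁ := satisfiesIdentity_syntacticMonoid.1
    (huv _ ((le_sup_left : ofLanguage L₁ ≤ _) (self_mem_generatedBy _))) φ
  have h₂ := satisfiesIdentity_syntacticMonoid.1
    (huv _ ((le_sup_right : ofLanguage L₂ ≤ _) (self_mem_generatedBy _))) φ
  have h_iff (p q : List Letter) :
      p ++ u.toList.flatMap φ ++ q = f ↔ p ++ v.toList.flatMap φ ++ q = f := by
    simp only [← Set.mem_singleton_iff (b := f), ← h, Set.mem_inter_iff, h₁ p q, h₂ p q]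
  rintro (⟨p, q, hpq⟩ | ⟨p, q, hpq⟩)
  · exact (List.append_cancel_left (List.append_cancel_right
      (((h_iff p q).1 hpq).trans hpq.symm))).symm
  · exact List.append_cancel_left (List.append_cancel_right
      (((h_iff p q).2 hpq).trans hpq.symm))

end MonoidVariety

open MonoidVariety in
theorem not_isDistributiveLattice_of_languages {w f g h f₀ : List Letter}
    {L₁ L₂ : Set (List Letter)} (h_inter : L₁ ∩ L₂ = {f})
    (h_closed₁ : IsClosedUnderIdentitiesOf w L₁) (h_closed₂ : IsClosedUnderIdentitiesOf w L₂)
    (hg : IsSyntacticIdentityOf L₁ f g) (hh : IsSyntacticIdentityOf L₂ f h)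
    (hg₀ : IsIdentityOf f g f₀) (hh₀ : IsIdentityOf f h f₀) (hne : f ≠ f₀) :
    ¬ IsDistributiveLattice (SubvarietyLattice (ofFactors w)) :=
  not_isDistributiveLattice_Iic (ofLanguage_le_ofFactors h_closed₁)
    (ofLanguage_le_ofFactors h_closed₂) (ofFactors_le_sup_ofLanguage h_inter)
    (inf_le_ofIdentity (ofLanguage_le_ofIdentity_iff.2 hg) (ofFactors_le_ofIdentity_iff.2 hg₀))
    (inf_le_ofIdentity (ofLanguage_le_ofIdentity_iff.2 hh) (ofFactors_le_ofIdentity_iff.2 hh₀))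
    fun hle => hne ((ofFactors_le_ofIdentity_iff.1 hle).eq_of_isInfix List.infix_rfl)

/-! ### Sandwich words -/

noncomputable instance : DecidableEq Letter := Classical.decEq _

/-- The word `∏ z_i` over a list of indices. -/
def zWord (Z : List ℕ) : List Letter := Z.map Letter.z

/-- The word `∏ z_i t_i` over a list of indices. -/
def ztWord (A : List ℕ) : List Letter := A.flatMap fun i => [Letter.z i, Letter.t i]

/-- The word `∏ t_i z_i` over a list of indices. -/
def tzWord (B : List ℕ) : List Letter := B.flatMap fun i => [Letter.t i, Letter.z i]

/-- The word `(∏ z_i t_i) c (∏ t_i z_i)`; the factor `c` is called its main block. -/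
def frame (A B : List ℕ) (c : List Letter) : List Letter := ztWord A ++ c ++ tzWord B

/-- A main block in which the letter `x` occurs twice. -/
def xBlock (X₁ Y X₂ : List ℕ) : List Letter :=
  zWord X₁ ++ Letter.x :: (zWord Y ++ Letter.x :: zWord X₂)

/-- The words through which the proof runs: the main block contains the letter `x` twice, and
`a_{n,m}[ρ]` is the case in which it begins and ends with `x`. -/
def sandwich (A B X₁ Y X₂ : List ℕ) : List Letter := frame A B (xBlock X₁ Y X₂)

/-- The partial map from letters to indices that is defined on the letters `z_i`. -/
def Letter.zIndex? : Letter → Option ℕ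
  | Letter.z i => some i
  | _ => none

section SandwichWords

variable {A B Z X Y X₁ X₂ : List ℕ} {c : List Letter} {i : ℕ}

@[simp] theorem zWord_nil : zWord [] = [] := rfl
@[simp] theorem zWord_cons : zWord (i :: Z) = Letter.z i :: zWord Z := rfl
@[simp] theorem zWord_append : zWord (X ++ Y) = zWord X ++ zWord Y := List.map_append
@[simp] theorem length_zWord : (zWord Z).length = Z.length := List.length_map _
@[simp] theorem ztWord_nil : ztWord [] = [] := rfl
@[simp] theorem ztWord_cons : ztWord (i :: Z) = Letter.z i :: Letter.t i :: ztWord Z := rfl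
@[simp] theorem ztWord_append : ztWord (X ++ Y) = ztWord X ++ ztWord Y := List.flatMap_append
@[simp] theorem tzWord_nil : tzWord [] = [] := rfl
@[simp] theorem tzWord_cons : tzWord (i :: Z) = Letter.t i :: Letter.z i :: tzWord Z := rfl
@[simp] theorem tzWord_append : tzWord (X ++ Y) = tzWord X ++ tzWord Y := List.flatMap_append

theorem zWord_injective : Function.Injective zWord :=
  List.map_injective_iff.2 fun _ _ h => Letter.z.inj h

theorem reverse_zWord : (zWord Z).reverse = zWord Z.reverse := List.map_reverse.symm

theorem reverse_ztWord : (ztWord Z).reverse = tzWord Z.reverse := by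
  rw [ztWord, List.reverse_flatMap]
  rfl

theorem reverse_tzWord : (tzWord Z).reverse = ztWord Z.reverse := by
  rw [tzWord, List.reverse_flatMap]
  rfl

theorem reverse_frame : (frame A B c).reverse = frame B.reverse A.reverse c.reverse := by
  simp only [frame, List.reverse_append, reverse_ztWord, reverse_tzWord, List.append_assoc]

theorem reverse_sandwich : (sandwich A B X₁ Y X₂).reverse =
    sandwich B.reverse A.reverse X₂.reverse Y.reverse X₁.reverse := by
  simp [sandwich, reverse_frame, xBlock, reverse_zWord]

theorem sandwich_eq : sandwich A B X₁ Y X₂ =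
    (ztWord A ++ zWord X₁) ++ [Letter.x] ++ zWord Y ++ [Letter.x] ++ (zWord X₂ ++ tzWord B) := by
  simp [sandwich, frame, xBlock]

@[simp] theorem z_mem_zWord : Letter.z i ∈ zWord Z ↔ i ∈ Z := by simp [zWord]
@[simp] theorem t_notMem_zWord : Letter.t i ∉ zWord Z := by simp [zWord]
@[simp] theorem x_notMem_zWord : Letter.x ∉ zWord Z := by simp [zWord]
@[simp] theorem z_mem_ztWord : Letter.z i ∈ ztWord Z ↔ i ∈ Z := by simp [ztWord]
@[simp] theorem t_mem_ztWord : Letter.t i ∈ ztWord Z ↔ i ∈ Z := by simp [ztWord]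
@[simp] theorem x_notMem_ztWord : Letter.x ∉ ztWord Z := by simp [ztWord]
@[simp] theorem z_mem_tzWord : Letter.z i ∈ tzWord Z ↔ i ∈ Z := by simp [tzWord]
@[simp] theorem t_mem_tzWord : Letter.t i ∈ tzWord Z ↔ i ∈ Z := by simp [tzWord]
@[simp] theorem x_notMem_tzWord : Letter.x ∉ tzWord Z := by simp [tzWord]

@[simp] theorem count_z_zWord : (zWord Z).count (Letter.z i) = Z.count i :=
  List.count_map_of_injective _ _ (fun _ _ h => Letter.z.inj h) _

@[simp] theorem count_t_zWord : (zWord Z).count (Letter.t i) = 0 :=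
  List.count_eq_zero.2 t_notMem_zWord

@[simp] theorem count_x_zWord : (zWord Z).count Letter.x = 0 :=
  List.count_eq_zero.2 x_notMem_zWord

@[simp] theorem count_z_ztWord : (ztWord Z).count (Letter.z i) = Z.count i := by
  induction Z with
  | nil => rfl
  | cons a Z ih => simp [ih, List.count_cons]

@[simp] theorem count_t_ztWord : (ztWord Z).count (Letter.t i) = Z.count i := by
  induction Z with
  | nil => rfl
  | cons a Z ih => simp [ih, List.count_cons]

@[simp] theorem count_x_ztWord : (ztWord Z).count Letter.x = 0 :=
  List.count_eq_zero.2 x_notMem_ztWord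

@[simp] theorem count_z_tzWord : (tzWord Z).count (Letter.z i) = Z.count i := by
  rw [← List.count_reverse, reverse_tzWord, count_z_ztWord, List.count_reverse]

@[simp] theorem count_t_tzWord : (tzWord Z).count (Letter.t i) = Z.count i := by
  rw [← List.count_reverse, reverse_tzWord, count_t_ztWord, List.count_reverse]

@[simp] theorem count_x_tzWord : (tzWord Z).count Letter.x = 0 :=
  List.count_eq_zero.2 x_notMem_tzWord

theorem count_z_xBlock : (xBlock X₁ Y X₂).count (Letter.z i) = (X₁ ++ Y ++ X₂).count i := by
  simp [xBlock]

theorem count_x_xBlock : (xBlock X₁ Y X₂).count Letter.x = 2 := by simp [xBlock]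

theorem t_notMem_xBlock : Letter.t i ∉ xBlock X₁ Y X₂ := by simp [xBlock]

theorem zWord_sublist_ztWord : (zWord Z).Sublist (ztWord Z) := by
  induction Z with
  | nil => exact List.Sublist.refl _
  | cons a Z ih => exact .cons_cons _ (.cons _ ih)

theorem filterMap_zIndex?_zWord : (zWord Z).filterMap Letter.zIndex? = Z := by
  rw [zWord, List.filterMap_map]
  exact List.filterMap_some

theorem filterMap_zIndex?_ztWord : (ztWord Z).filterMap Letter.zIndex? = Z := by
  induction Z with
  | nil => rfl
  | cons a Z ih => exact congrArg (a :: ·) ih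

end SandwichWords

/-- The indices of the letters before and after the main block, together, are those inside it. -/
structure BlockBalanced (A B Z : List ℕ) : Prop where
  nodup : Z.Nodup
  perm : Z.Perm (A ++ B)

namespace BlockBalanced

variable {A B Z : List ℕ} {i : ℕ}

theorem mem_iff (h : BlockBalanced A B Z) : i ∈ Z ↔ i ∈ A ∨ i ∈ B := by
  rw [h.perm.mem_iff, List.mem_append]

theorem nodup_append (h : BlockBalanced A B Z) : (A ++ B).Nodup := h.perm.nodup h.nodup

theorem nodup_left (h : BlockBalanced A B Z) : A.Nodup := h.nodup_append.of_append_left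

theorem nodup_right (h : BlockBalanced A B Z) : B.Nodup := h.nodup_append.of_append_right

theorem disjoint (h : BlockBalanced A B Z) : A.Disjoint B :=
  List.disjoint_of_nodup_append h.nodup_append

theorem count_add_count (h : BlockBalanced A B Z) : A.count i + B.count i = Z.count i := by
  rw [← List.count_append, h.perm.count_eq]

theorem reverse (h : BlockBalanced A B Z) : BlockBalanced B.reverse A.reverse Z.reverse where
  nodup := List.nodup_reverse.2 h.nodup
  perm := by
    rw [← List.reverse_append]
    exact (List.reverse_perm _).trans (h.perm.trans (List.reverse_perm _).symm)

end BlockBalanced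

/-! ### Factors without linear letters -/

theorem ztWord_isPrefix_of_append_isPrefix {A : List ℕ} {V₁ V₂ D : List Letter}
    (h : V₁ ++ V₂ <+: ztWord A ++ D) (ht : ∀ i, Letter.t i ∉ V₂) (hl : 2 ≤ V₂.length) :
    ztWord A <+: V₁ := by
  obtain ⟨a, b, V₂, rfl⟩ : ∃ a b V, V₂ = a :: b :: V := by
    match V₂, hl with
    | a :: b :: V, _ => exact ⟨a, b, V, rfl⟩
  induction A generalizing V₁ with
  | nil => exact V₁.nil_prefix
  | cons i A ih =>
    rcases V₁ with _ | ⟨l, _ | ⟨l', V₁⟩⟩ <;>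
      simp only [ztWord_cons, List.cons_append, List.nil_append, List.cons_prefix_cons] at h ⊢
    · exact absurd (by simp [h.2.1]) (ht i)
    · exact absurd (by simp [h.2.1]) (ht i)
    · exact ⟨h.1.symm, h.2.1.symm, ih h.2.2⟩

theorem tzWord_isSuffix_of_append_isSuffix {B : List ℕ} {V₂ V₃ D : List Letter}
    (h : V₂ ++ V₃ <:+ D ++ tzWord B) (ht : ∀ i, Letter.t i ∉ V₂) (hl : 2 ≤ V₂.length) :
    tzWord B <:+ V₃ := by
  rw [← List.reverse_prefix, reverse_tzWord]
  refine ztWord_isPrefix_of_append_isPrefix (V₂ := V₂.reverse) (D := D.reverse) ?_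
    (by simpa using ht) (by simpa using hl)
  simpa [reverse_tzWord] using List.reverse_prefix.2 h

/-- The linear letters `t_i` separate the letters outside the main block from each other. -/
theorem exists_eq_of_append_eq_frame {A B : List ℕ} {V₁ V₂ V₃ c : List Letter}
    (h : V₁ ++ V₂ ++ V₃ = frame A B c) (ht : ∀ i, Letter.t i ∉ V₂) (hl : 2 ≤ V₂.length) :
    ∃ s₁ s₂, V₁ = ztWord A ++ s₁ ∧ V₃ = s₂ ++ tzWord B ∧ c = s₁ ++ V₂ ++ s₂ := by
  obtain ⟨s₁, rfl⟩ := ztWord_isPrefix_of_append_isPrefix (V₁ := V₁) (D := c ++ tzWord B)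
    ⟨V₃, by rw [h, frame, List.append_assoc]⟩ ht hl
  obtain ⟨s₂, rfl⟩ := tzWord_isSuffix_of_append_isSuffix (V₃ := V₃) (D := ztWord A ++ c)
    ⟨ztWord A ++ s₁, by rw [← List.append_assoc, h, frame]⟩ ht hl
  refine ⟨s₁, s₂, rfl, rfl, ?_⟩
  have h' : c ++ tzWord B = (s₁ ++ V₂ ++ s₂) ++ tzWord B := by simpa [frame] using h.symm
  exact List.append_cancel_right h'

section RepeatedFactors

variable {A B Z X₁ Y X₂ : List ℕ} {a b c s : List Letter}

theorem eq_x_of_two_le_count_xBlock {l : Letter} (hZ : (X₁ ++ Y ++ X₂).Nodup)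
    (h : 2 ≤ (xBlock X₁ Y X₂).count l) : l = Letter.x := by
  rcases l with _ | i | i
  · rfl
  · rw [count_z_xBlock] at h
    exact absurd (h.trans (List.nodup_iff_count_le_one.1 hZ i)) (by decide)
  · rw [List.count_eq_zero.2 t_notMem_xBlock] at h
    exact absurd h (by decide)

theorem count_t_sandwich_le (hB : BlockBalanced A B Z) (i : ℕ) :
    (sandwich A B X₁ Y X₂).count (Letter.t i) ≤ 1 := by
  simpa [sandwich, frame, List.count_eq_zero.2 t_notMem_xBlock, hB.count_add_count] using
    List.nodup_iff_count_le_one.1 hB.nodup i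

theorem t_notMem_of_repeated (hB : BlockBalanced A B (X₁ ++ Y ++ X₂))
    (h : a ++ s ++ b ++ s ++ c = sandwich A B X₁ Y X₂) (i : ℕ) : Letter.t i ∉ s := fun hi => by
  have h_le := count_t_sandwich_le (X₁ := X₁) (Y := Y) (X₂ := X₂) hB i
  have h_pos := List.count_pos_iff.2 hi
  simp only [← h, List.count_append] at h_le
  omega

theorem length_le_one_of_repeated (hB : BlockBalanced A B (X₁ ++ Y ++ X₂))
    (h : a ++ s ++ b ++ s ++ c = sandwich A B X₁ Y X₂) : s.length ≤ 1 := by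
  have ht := t_notMem_of_repeated hB h
  by_contra! hl
  obtain ⟨s₁, -, rfl, -, -⟩ := exists_eq_of_append_eq_frame (V₁ := a) (V₃ := b ++ s ++ c)
    (by simpa [sandwich] using h) ht hl
  obtain ⟨s₁', s₂, hs₁, -, h_block⟩ := exists_eq_of_append_eq_frame h ht hl
  obtain rfl : s₁ ++ s ++ b = s₁' := by simpa using hs₁
  have h_count (l : Letter) := congrArg (List.count l) h_block
  simp only [List.count_append] at h_count
  have hx (l : Letter) (hl : l ∈ s) : Letter.x = l := by
    have := List.count_pos_iff.2 hl
    exact (eq_x_of_two_le_count_xBlock hB.nodup (by rw [h_count l]; omega)).symm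
  have := h_count Letter.x
  rw [count_x_xBlock, List.count_eq_length.2 hx] at this
  omega

theorem append_cons_inj_of_notMem_left {α : Type*} {l : α} {s s' r r' : List α} (hs : l ∉ s)
    (hs' : l ∉ s') (h : s ++ l :: r = s' ++ l :: r') : s = s' ∧ r = r' := by
  rcases List.append_eq_append_iff.1 h with ⟨t, rfl, ht⟩ | ⟨t, rfl, ht⟩ <;> rcases t with _ | ⟨a, t⟩
  · simpa using ht
  · exact absurd (by simp [(List.cons.inj ht).1]) hs'
  · simpa using ht.symm
  · exact absurd (by simp [(List.cons.inj ht).1]) hs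

theorem eq_of_repeated_of_t_notMem (hB : BlockBalanced A B (X₁ ++ Y ++ X₂))
    (h : a ++ s ++ b ++ s ++ c = sandwich A B X₁ Y X₂) (hs : s ≠ [])
    (hb : ∀ i, Letter.t i ∉ b) : s = [Letter.x] ∧ a = ztWord A ++ zWord X₁ ∧ b = zWord Y ∧
      c = zWord X₂ ++ tzWord B := by
  obtain ⟨l, rfl⟩ : ∃ l, s = [l] := List.length_eq_one_iff.1
    (le_antisymm (length_le_one_of_repeated hB h) (List.length_pos_iff.2 hs))
  have hl := t_notMem_of_repeated hB h
  obtain ⟨s₁, s₂, rfl, rfl, h_block⟩ := exists_eq_of_append_eq_frame (V₂ := [l] ++ b ++ [l])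
    (by simpa [sandwich] using h) (fun i hi => by simp_all) (by simp)
  have h_count := congrArg (List.count l) h_block
  simp only [List.count_append, List.count_singleton_self] at h_count
  obtain rfl := eq_x_of_two_le_count_xBlock hB.nodup (by rw [h_count]; omega)
  rw [count_x_xBlock] at h_count
  have h₁ : Letter.x ∉ s₁ := List.count_eq_zero.1 (by omega)
  have hb' : Letter.x ∉ b := List.count_eq_zero.1 (by omega)
  have h_eq : zWord X₁ ++ Letter.x :: (zWord Y ++ Letter.x :: zWord X₂) =
      s₁ ++ Letter.x :: (b ++ Letter.x :: s₂) := by simpa [xBlock] using h_block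
  obtain ⟨rfl, h_tail⟩ := append_cons_inj_of_notMem_left x_notMem_zWord h₁ h_eq
  obtain ⟨rfl, rfl⟩ := append_cons_inj_of_notMem_left x_notMem_zWord hb' h_tail
  exact ⟨rfl, rfl, rfl, rfl⟩

end RepeatedFactors

/-! ### Substitutions between sandwich words -/

/-- The substitution `φ` maps a sandwich word into another one over the same frame, part by part,
and `f` describes its effect on the indices of the main block: `none` stands for an erased
letter. -/
structure RespectsBlocks (A B : List ℕ) (φ : Letter → List Letter) (f : ℕ → Option ℕ)
    (p q : List Letter) (X₁ Y X₂ X₁' Y' X₂' : List ℕ) : Prop where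
  map_x : φ Letter.x = [Letter.x]
  map_z : ∀ i ∈ X₁ ++ Y ++ X₂, φ (Letter.z i) = zWord (f i).toList
  left : p ++ (ztWord A ++ zWord X₁).flatMap φ = ztWord A ++ zWord X₁'
  middle : Y.filterMap f = Y'
  right : (zWord X₂ ++ tzWord B).flatMap φ ++ q = zWord X₂' ++ tzWord B

section

variable {A B X₁ Y X₂ X₁' Y' X₂' T : List ℕ} {φ : Letter → List Letter} {f : ℕ → Option ℕ}
  {p q : List Letter}

theorem flatMap_zWord (h : ∀ i ∈ T, φ (Letter.z i) = zWord (f i).toList) :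
    (zWord T).flatMap φ = zWord (T.filterMap f) := by
  induction T with
  | nil => rfl
  | cons a T ih =>
    rw [List.forall_mem_cons] at h
    rw [zWord_cons, List.flatMap_cons, h.1, ih h.2, List.filterMap_cons]
    cases f a <;> rfl

theorem append_flatMap_sandwich_append : p ++ (sandwich A B X₁ Y X₂).flatMap φ ++ q =
    (p ++ (ztWord A ++ zWord X₁).flatMap φ) ++ φ Letter.x ++ (zWord Y).flatMap φ ++ φ Letter.x ++
      ((zWord X₂ ++ tzWord B).flatMap φ ++ q) := by
  simp [sandwich_eq]

theorem exists_eq_zWord_toList {s : List Letter} (hx : Letter.x ∉ s) (ht : ∀ i, Letter.t i ∉ s)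
    (hs : s.length ≤ 1) : ∃ o : Option ℕ, s = zWord o.toList := by
  match s, hs with
  | [], _ => exact ⟨none, rfl⟩
  | [Letter.x], _ => exact absurd (List.mem_singleton_self _) hx
  | [Letter.t i], _ => exact absurd (List.mem_singleton_self _) (ht i)
  | [Letter.z i], _ => exact ⟨some i, rfl⟩

theorem exists_sandwich_eq_append_z_append_z {i : ℕ} (hB : BlockBalanced A B (X₁ ++ Y ++ X₂))
    (hi : i ∈ X₁ ++ Y ++ X₂) : ∃ a b c,
      sandwich A B X₁ Y X₂ = a ++ [Letter.z i] ++ b ++ [Letter.z i] ++ c := by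
  obtain ⟨c₁, c₂, hc⟩ : ∃ c₁ c₂, xBlock X₁ Y X₂ = c₁ ++ Letter.z i :: c₂ :=
    List.append_of_mem (by simpa [xBlock] using hi)
  rw [sandwich, hc]
  rcases hB.mem_iff.1 hi with h | h
  · obtain ⟨a, b, hab⟩ := List.append_of_mem (z_mem_ztWord.2 h)
    exact ⟨a, b ++ c₁, c₂ ++ tzWord B, by simp [frame, hab]⟩
  · obtain ⟨a, b, hab⟩ := List.append_of_mem (z_mem_tzWord.2 h)
    exact ⟨ztWord A ++ c₁, c₂ ++ a, b, by simp [frame, hab]⟩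

theorem exists_respectsBlocks (hB : BlockBalanced A B (X₁ ++ Y ++ X₂))
    (hB' : BlockBalanced A B (X₁' ++ Y' ++ X₂'))
    (h : p ++ (sandwich A B X₁ Y X₂).flatMap φ ++ q = sandwich A B X₁' Y' X₂')
    (hx : φ Letter.x ≠ []) : ∃ f, RespectsBlocks A B φ f p q X₁ Y X₂ X₁' Y' X₂' := by
  have hz (i) (hi : i ∈ X₁ ++ Y ++ X₂) :
      (∀ j, Letter.t j ∉ φ (Letter.z i)) ∧ (φ (Letter.z i)).length ≤ 1 := by
    obtain ⟨a, b, c, habc⟩ := exists_sandwich_eq_append_z_append_z hB hi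
    have h_rep : (p ++ a.flatMap φ) ++ φ (Letter.z i) ++ b.flatMap φ ++ φ (Letter.z i) ++
        (c.flatMap φ ++ q) = sandwich A B X₁' Y' X₂' := by
      rw [← h, habc]
      simp
    exact ⟨t_notMem_of_repeated hB' h_rep, length_le_one_of_repeated hB' h_rep⟩
  have ht (j) : Letter.t j ∉ (zWord Y).flatMap φ := fun hj => by
    obtain ⟨_, hl, hj⟩ := List.mem_flatMap.1 hj
    obtain ⟨i, hi, rfl⟩ := List.mem_map.1 hl
    exact (hz i (by simp [hi])).1 j hj
  obtain ⟨h_x, h_left, h_mid, h_right⟩ := eq_of_repeated_of_t_notMem hB'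
    (append_flatMap_sandwich_append.symm.trans h) hx ht
  have hzx (i) (hi : i ∈ X₁ ++ Y ++ X₂) : Letter.x ∉ φ (Letter.z i) := fun hmem => by
    rcases hB.mem_iff.1 hi with hA | hB
    · have : Letter.x ∈ ztWord A ++ zWord X₁' := h_left ▸ List.mem_append_right _
        (List.mem_flatMap.2 ⟨_, List.mem_append_left _ (z_mem_ztWord.2 hA), hmem⟩)
      simp at this
    · have : Letter.x ∈ zWord X₂' ++ tzWord B := h_right ▸ List.mem_append_left _
        (List.mem_flatMap.2 ⟨_, List.mem_append_right _ (z_mem_tzWord.2 hB), hmem⟩)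
      simp at this
  choose! f hf using fun i hi => exists_eq_zWord_toList (hzx i hi) (hz i hi).1 (hz i hi).2
  refine ⟨f, h_x, hf, h_left, zWord_injective ?_, h_right⟩
  rw [← h_mid, flatMap_zWord fun i hi => hf i (by simp [hi])]

namespace RespectsBlocks

theorem flatMap_middle (h : RespectsBlocks A B φ f p q X₁ Y X₂ X₁' Y' X₂') :
    (zWord Y).flatMap φ = zWord Y' := by
  rw [flatMap_zWord fun i hi => h.map_z i (by simp [hi]), h.middle]

theorem append_flatMap_append (h : RespectsBlocks A B φ f p q X₁ Y X₂ X₁' Y' X₂') :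
    p ++ (sandwich A B X₁ Y X₂).flatMap φ ++ q = sandwich A B X₁' Y' X₂' := by
  rw [append_flatMap_sandwich_append, h.left, h.map_x, h.flatMap_middle, h.right, sandwich_eq]

theorem reverse (h : RespectsBlocks A B φ f p q X₁ Y X₂ X₁' Y' X₂') :
    RespectsBlocks B.reverse A.reverse (fun l => (φ l).reverse) f q.reverse p.reverse
      X₂.reverse Y.reverse X₁.reverse X₂'.reverse Y'.reverse X₁'.reverse where
  map_x := by rw [h.map_x]; rfl
  map_z i hi := by
    rw [h.map_z i (by simpa [or_assoc, or_comm, or_left_comm] using hi), reverse_zWord]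
    cases f i <;> rfl
  left := by
    simpa [List.reverse_flatMap, Function.comp_def, reverse_zWord, reverse_tzWord] using
      congrArg List.reverse h.right
  middle := by rw [List.filterMap_reverse, h.middle]
  right := by
    simpa [List.reverse_flatMap, Function.comp_def, reverse_zWord, reverse_ztWord] using
      congrArg List.reverse h.left

theorem filterMap_sublist_left (h : RespectsBlocks A B φ f p q X₁ Y X₂ X₁' Y' X₂')
    (hX : X₁'.Disjoint Y') (hT : T.Sublist A) (hTY : T ⊆ Y) : (T.filterMap f).Sublist A := by
  have h_sub : (zWord (T.filterMap f)).Sublist (ztWord A ++ zWord X₁') := by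
    rw [← h.left, ← flatMap_zWord fun i hi => h.map_z i (by simp [hTY hi]), List.flatMap_append]
    refine .trans (.flatMap ?_ φ) ((List.sublist_append_left _ _).trans
      (List.sublist_append_right _ _))
    exact zWord_sublist_ztWord.trans (hT.flatMap _)
  have h_sub' : (T.filterMap f).Sublist (A ++ X₁') := by
    simpa [filterMap_zIndex?_zWord, filterMap_zIndex?_ztWord] using h_sub.filterMap Letter.zIndex?
  have h_notMem (j) (hj : j ∈ T.filterMap f) : j ∉ X₁' := fun hj' => by
    refine hX hj' (h.middle ▸ ?_)
    obtain ⟨i, hi, hij⟩ := List.mem_filterMap.1 hj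
    exact List.mem_filterMap.2 ⟨i, hTY hi, hij⟩
  have h_filter := h_sub'.filter (· ∉ X₁')
  have h_nil : X₁'.filter (· ∉ X₁') = [] := List.filter_eq_nil_iff.2 (by simp)
  rw [List.filter_eq_self.2 (by simpa using h_notMem), List.filter_append, h_nil,
    List.append_nil] at h_filter
  exact h_filter.trans List.filter_sublist

theorem filterMap_sublist_right (h : RespectsBlocks A B φ f p q X₁ Y X₂ X₁' Y' X₂')
    (hX : X₂'.Disjoint Y') (hT : T.Sublist B) (hTY : T ⊆ Y) : (T.filterMap f).Sublist B := by
  rw [← List.reverse_sublist, ← List.filterMap_reverse]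
  exact h.reverse.filterMap_sublist_left (by simpa [List.Disjoint] using hX)
    (List.reverse_sublist.2 hT) (by simpa [List.subset_def] using hTY)

end RespectsBlocks

end

/-! ### Shifts of the main block -/

/-- The pattern at the beginning of the main block that excludes shifts of the block: the letters
`a₀, a₂, a₁` come from one side of the frame, in the order `a₀, a₁, a₂` there, and the letters
between them come from the other side. -/
def IsRigidStart (A B : List ℕ) (a₀ d₁ a₂ d₂ a₁ : ℕ) : Prop :=
  ([a₀, a₁, a₂].Sublist A ∧ d₁ ∈ B ∧ d₂ ∈ B) ∨ ([a₀, a₁, a₂].Sublist B ∧ d₁ ∈ A ∧ d₂ ∈ A)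

section RigidStart

theorem not_sublist_pair_swap {α : Type*} {l : List α} {a b : α} (hl : l.Nodup)
    (h : [a, b].Sublist l) : ¬ [b, a].Sublist l := fun h' => by
  classical
  have h_lt : l.Pairwise fun i j => l.idxOf i < l.idxOf j := List.pairwise_iff_getElem.2
    fun i j hi hj hij => by rwa [hl.idxOf_getElem, hl.idxOf_getElem]
  have h_idx {c d : α} (hcd : [c, d].Sublist l) : l.idxOf c < l.idxOf d :=
    List.rel_of_pairwise_cons (h_lt.sublist hcd) (List.mem_singleton_self d)
  exact lt_asymm (h_idx h) (h_idx h')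

variable {S S' : List ℕ} {a₀ d₁ a₂ d₂ a₁ : ℕ} {T : List ℕ} {f : ℕ → Option ℕ}

theorem not_map_of_rigid (hS : S.Nodup) (hdisj : S.Disjoint S') (ha : [a₀, a₁, a₂].Sublist S)
    (hd₁ : d₁ ∈ S') (hd₂ : d₂ ∈ S')
    (hfS : ∀ L ⊆ [a₀, d₁, a₂, d₂, a₁], L.Sublist S → (L.filterMap f).Sublist S)
    (hfS' : ∀ L ⊆ [a₀, d₁, a₂, d₂, a₁], L.Sublist S' → (L.filterMap f).Sublist S') :
    (∀ i ∈ [a₀, a₁, a₂], ∀ j ∈ [d₁, d₂], f i ≠ some j) ∧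
      (∀ i ∈ [d₁, d₂], ∀ j ∈ [a₀, a₁, a₂], f i ≠ some j) ∧
      (∀ i ∈ [a₁, a₂], f a₀ = some a₂ → f i ≠ some a₁) := by
  have hd : [d₁, d₂] ⊆ S' := by simp [hd₁, hd₂]
  refine ⟨fun i hi j hj hij => ?_, fun i hi j hj hij => ?_, fun i hi h0 hi1 => ?_⟩
  · refine hdisj (a := j) ?_ (hd hj)
    simpa [hij] using hfS [i] (by simp at hi ⊢; tauto) (by simpa using ha.subset hi)
  · refine hdisj (ha.subset hj) ?_
    simpa [hij] using hfS' [i] (by simp at hi ⊢; tauto) (by simpa using hd hi)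
  · have h_pair : [a₀, i].Sublist [a₀, a₁, a₂] := by simpa using hi
    refine not_sublist_pair_swap hS ((List.sublist_cons_self _ _).trans ha) ?_
    simpa [h0, hi1] using hfS [a₀, i] (by simp at hi ⊢; tauto) (h_pair.trans ha)

theorem exists_eq_some_of_shift (h : (d₁ :: a₂ :: d₂ :: a₁ :: T).filterMap f = d₂ :: a₁ :: T) :
    ∃ i ∈ [d₁, a₂, d₂, a₁], f i = some a₁ := by
  have h_app : [d₁, a₂, d₂, a₁].filterMap f ++ T.filterMap f = [d₂, a₁] ++ T := by
    rw [← List.filterMap_append]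
    exact h
  have h_prefix : [d₂, a₁] <+: [d₁, a₂, d₂, a₁].filterMap f := by
    refine List.prefix_of_prefix_length_le ⟨T, rfl⟩ ⟨T.filterMap f, h_app⟩ ?_
    have h_len := congrArg List.length h_app
    have h_len_le := List.length_filterMap_le f T
    rw [List.length_append, List.length_append] at h_len
    omega
  exact List.mem_filterMap.1 (h_prefix.subset (a := a₁) (by simp))

theorem filterMap_eq_self_of_not_map {P₁ P₂ : List ℕ} (hP : P₁ ++ P₂ = [a₀, d₁])
    (h : (a₀ :: d₁ :: a₂ :: d₂ :: a₁ :: T).filterMap f = P₂ ++ a₂ :: d₂ :: a₁ :: T)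
    (h_ad : ∀ i ∈ [a₀, a₁, a₂], ∀ j ∈ [d₁, d₂], f i ≠ some j)
    (h_da : ∀ i ∈ [d₁, d₂], ∀ j ∈ [a₀, a₁, a₂], f i ≠ some j)
    (h_swap : ∀ i ∈ [a₁, a₂], f a₀ = some a₂ → f i ≠ some a₁) :
    (a₂ :: d₂ :: a₁ :: T).filterMap f = a₂ :: d₂ :: a₁ :: T := by
  suffices h_le : ([a₀, d₁].filterMap f).length ≤ P₂.length by
    have h_app : [a₀, d₁].filterMap f ++ (a₂ :: d₂ :: a₁ :: T).filterMap f =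
        P₂ ++ a₂ :: d₂ :: a₁ :: T := by
      rw [← List.filterMap_append]
      exact h
    have h_len := congrArg List.length h_app
    have h_len_le := List.length_filterMap_le f (a₂ :: d₂ :: a₁ :: T)
    rw [List.length_append, List.length_append] at h_len
    exact (List.append_inj' h_app (by omega)).2
  rcases P₁ with _ | ⟨b₀, _ | ⟨b₁, P₁⟩⟩
  · obtain rfl : P₂ = [a₀, d₁] := hP
    exact List.length_filterMap_le _ _
  · obtain ⟨rfl, rfl⟩ : b₀ = a₀ ∧ P₂ = [d₁] := by simpa using hP
    rcases h₀ : f b₀ with _ | j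
    · rw [List.filterMap_cons_none h₀]
      exact List.length_filterMap_le _ _
    · rw [List.filterMap_cons_some h₀] at h
      exact absurd (h₀.trans (congrArg some (List.cons.inj h).1)) (h_ad _ (by simp) _ (by simp))
  · obtain ⟨rfl, rfl, -, rfl⟩ : b₀ = a₀ ∧ b₁ = d₁ ∧ P₁ = [] ∧ P₂ = [] := by simpa using hP
    rcases h₀ : f b₀ with _ | j
    · rcases h₁ : f b₁ with _ | j
      · rw [List.filterMap_cons_none h₀, List.filterMap_cons_none h₁]
        rfl
      · rw [List.filterMap_cons_none h₀, List.filterMap_cons_some h₁] at h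
        exact absurd (h₁.trans (congrArg some (List.cons.inj h).1))
          (h_da _ (by simp) _ (by simp))
    · rw [List.filterMap_cons_some h₀] at h
      obtain ⟨rfl, h_tail⟩ := List.cons.inj h
      obtain ⟨i, hi, hi₁⟩ := exists_eq_some_of_shift h_tail
      by_cases hid : i ∈ [b₁, d₂]
      · exact absurd hi₁ (h_da i hid _ (by simp))
      · exact absurd hi₁ (h_swap i (by simp at hi hid ⊢; tauto) h₀)

end RigidStart

section LeftLanguage

variable {A B P P₁ P₂ I X₁ Y X₂ : List ℕ} {φ : Letter → List Letter} {f : ℕ → Option ℕ}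
  {p q : List Letter}

namespace RespectsBlocks

theorem filterMap_eq_self_of_isRigidStart {a₀ d₁ a₂ d₂ a₁ : ℕ} {T : List ℕ}
    (hB : BlockBalanced A B (a₀ :: d₁ :: a₂ :: d₂ :: a₁ :: T))
    (hr : IsRigidStart A B a₀ d₁ a₂ d₂ a₁) (hP : P₁ ++ P₂ = [a₀, d₁])
    (h : RespectsBlocks A B φ f p q [] (a₀ :: d₁ :: a₂ :: d₂ :: a₁ :: T) []
      P₁ (P₂ ++ a₂ :: d₂ :: a₁ :: T) []) :
    (a₂ :: d₂ :: a₁ :: T).filterMap f = a₂ :: d₂ :: a₁ :: T := by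
  have h_subset : [a₀, d₁, a₂, d₂, a₁] ⊆ a₀ :: d₁ :: a₂ :: d₂ :: a₁ :: T :=
    List.subset_append_left [a₀, d₁, a₂, d₂, a₁] T
  have h_disjoint : P₁.Disjoint (P₂ ++ a₂ :: d₂ :: a₁ :: T) := by
    refine List.disjoint_of_nodup_append ?_
    rw [← List.append_assoc, hP]
    exact hB.nodup
  have hA (L : List ℕ) (hL : L ⊆ [a₀, d₁, a₂, d₂, a₁]) (hLA : L.Sublist A) :=
    h.filterMap_sublist_left h_disjoint hLA fun i hi => h_subset (hL hi)
  have hB' (L : List ℕ) (hL : L ⊆ [a₀, d₁, a₂, d₂, a₁]) (hLB : L.Sublist B) :=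
    h.filterMap_sublist_right (List.disjoint_nil_left _) hLB fun i hi => h_subset (hL hi)
  obtain ⟨h_ad, h_da, h_swap⟩ := hr.elim
    (fun ⟨ha, hd₁, hd₂⟩ => not_map_of_rigid hB.nodup_left hB.disjoint ha hd₁ hd₂ hA hB')
    (fun ⟨ha, hd₁, hd₂⟩ => not_map_of_rigid hB.nodup_right hB.disjoint.symm ha hd₁ hd₂ hB' hA)
  exact filterMap_eq_self_of_not_map hP h.middle h_ad h_da h_swap

theorem move_right (h : RespectsBlocks A B φ f p q [] (P ++ I) [] P₁ (P₂ ++ I) [])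
    (hP : P₁ ++ P₂ = P) (hI : I.filterMap f = I) : RespectsBlocks A B φ f p q P I [] P I [] where
  map_x := h.map_x
  map_z := by simpa using h.map_z
  left := by
    have h_P : P.filterMap f = P₂ :=
      List.append_cancel_right (by rw [← h.middle, List.filterMap_append, hI])
    have h_left : p ++ (ztWord A).flatMap φ = ztWord A ++ zWord P₁ := by simpa using h.left
    rw [List.flatMap_append, ← List.append_assoc, h_left,
      flatMap_zWord fun i hi => h.map_z i (by simp [hi]), h_P, List.append_assoc, ← zWord_append,
      hP]
  middle := hI
  right := h.right

theorem exists_move_left (h : RespectsBlocks A B φ f p q P I [] P I []) : ∃ P₁ P₂,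
    P₁ ++ P₂ = P ∧ RespectsBlocks A B φ f p q [] (P ++ I) [] P₁ (P₂ ++ I) [] := by
  have h_left : (p ++ (ztWord A).flatMap φ) ++ zWord (P.filterMap f) = ztWord A ++ zWord P := by
    rw [← h.left, List.flatMap_append, flatMap_zWord fun i hi => h.map_z i (by simp [hi]),
      List.append_assoc]
  obtain ⟨s, hs⟩ : zWord (P.filterMap f) <:+ zWord P :=
    List.suffix_of_suffix_length_le ⟨_, h_left⟩ ⟨_, rfl⟩
      (by simpa using List.length_filterMap_le f P)
  obtain ⟨P₁, P₂, rfl, rfl, hP₂⟩ := List.map_eq_append_iff.1 hs.symm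
  have h_filterMap : (P₁ ++ P₂).filterMap f = P₂ := (zWord_injective hP₂).symm
  refine ⟨P₁, P₂, rfl, h.map_x, by simpa using h.map_z, ?_, ?_, h.right⟩
  · rw [h_filterMap, zWord_append, ← List.append_assoc] at h_left
    simpa using List.append_cancel_right h_left
  · rw [List.filterMap_append, h.middle, h_filterMap]

end RespectsBlocks

/-- The words that arise from the sandwich word with main block `x P Q x` by moving the first `x`
inside `P`. -/
def leftLanguage (A B P Q : List ℕ) : Set (List Letter) :=
  {u | ∃ P₁ P₂, P₁ ++ P₂ = P ∧ u = sandwich A B P₁ (P₂ ++ Q) []}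

theorem isSyntacticIdentityOf_leftLanguage {a₀ d₁ a₂ d₂ a₁ : ℕ} {T : List ℕ}
    (hB : BlockBalanced A B (a₀ :: d₁ :: a₂ :: d₂ :: a₁ :: T))
    (hr : IsRigidStart A B a₀ d₁ a₂ d₂ a₁) :
    IsSyntacticIdentityOf (leftLanguage A B [a₀, d₁] (a₂ :: d₂ :: a₁ :: T))
      (sandwich A B [] (a₀ :: d₁ :: a₂ :: d₂ :: a₁ :: T) [])
      (sandwich A B [a₀, d₁] (a₂ :: d₂ :: a₁ :: T) []) := fun φ p q => by
  have hB' {P₁ P₂ : List ℕ} (hP : P₁ ++ P₂ = [a₀, d₁]) :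
      BlockBalanced A B (P₁ ++ (P₂ ++ a₂ :: d₂ :: a₁ :: T) ++ []) := by
    rw [List.append_nil, ← List.append_assoc, hP]
    exact hB
  by_cases hx : φ Letter.x = []
  · simp [sandwich_eq, hx]
  constructor
  · rintro ⟨P₁, P₂, hP, h⟩
    obtain ⟨f, hf⟩ := exists_respectsBlocks (by simpa using hB) (hB' hP) h hx
    have h_fix := hf.filterMap_eq_self_of_isRigidStart hB hr hP
    exact ⟨_, _, List.append_nil _, (hf.move_right (P := [a₀, d₁]) hP h_fix).append_flatMap_append⟩
  · rintro ⟨P₁, P₂, hP, h⟩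
    obtain ⟨f, hf⟩ := exists_respectsBlocks (by simpa using hB) (hB' hP) h hx
    obtain rfl : P₂ = [] := List.length_eq_zero_iff.1 <| by
      have := List.length_filterMap_le f (a₂ :: d₂ :: a₁ :: T)
      rw [hf.middle, List.length_append] at this
      omega
    obtain rfl : P₁ = [a₀, d₁] := by simpa using hP
    obtain ⟨Q₁, Q₂, hQ, hf'⟩ := RespectsBlocks.exists_move_left hf
    exact ⟨Q₁, Q₂, hQ, hf'.append_flatMap_append⟩

theorem isIdentityOf_of_shorter (hB : BlockBalanced A B (X₁ ++ Y ++ X₂))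
    (hY : Y.length < (X₁ ++ Y ++ X₂).length) :
    IsIdentityOf (sandwich A B [] (X₁ ++ Y ++ X₂) []) (sandwich A B X₁ Y X₂)
      (Letter.x :: Letter.x :: frame A B (zWord (X₁ ++ Y ++ X₂))) := fun φ hφ => by
  have hB' : BlockBalanced A B ([] ++ (X₁ ++ Y ++ X₂) ++ []) := by simpa using hB
  by_cases hx : φ Letter.x = []
  · simp [sandwich_eq, frame, hx]
  exfalso
  rcases hφ with ⟨p, q, h⟩ | ⟨p, q, h⟩
  · obtain ⟨f, hf⟩ := exists_respectsBlocks hB hB' h hx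
    have := List.length_filterMap_le f Y
    rw [hf.middle] at this
    omega
  · obtain ⟨-, -, h_mid, -⟩ := eq_of_repeated_of_t_notMem hB' (a := p) (s := φ Letter.x) (b := [])
      (c := (frame A B (zWord (X₁ ++ Y ++ X₂))).flatMap φ ++ q) (by rw [← h]; simp) hx (by simp)
    rw [← zWord_injective (a₁ := []) h_mid] at hY
    exact Nat.not_lt_zero _ hY

end LeftLanguage

/-! ### Restrictions of words -/

/-- The word obtained from `u` by deleting all letters outside of `S`. -/
def restrict {α : Type*} [DecidableEq α] (S u : List α) : List α := u.filter (· ∈ S)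

theorem exists_eq_append_cons_cons_of_ne_head {α : Type*} {u : List α} {a c : α} (hc : c ∈ u)
    (hca : c ≠ a) : ∃ p e q, a :: u = p ++ e :: c :: q ∧ c ∉ p ∧ c ≠ e := by
  obtain ⟨p, q, rfl, hp⟩ := List.eq_append_cons_of_mem hc
  have hp' : c ∉ a :: p := by simp [hca, hp]
  obtain ⟨p', e, h⟩ := List.eq_nil_or_concat' (a :: p) |>.resolve_left (List.cons_ne_nil _ _)
  rw [h, List.mem_append, List.mem_singleton, not_or] at hp'
  exact ⟨p', e, q, by rw [← List.cons_append, h, List.append_assoc]; rfl, hp'⟩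

section Restrict

variable {α β : Type*} [DecidableEq α] {S T u v s : List α} {a b c l : α}

theorem restrict_cons_of_mem (h : a ∈ S) : restrict S (a :: u) = a :: restrict S u :=
  List.filter_cons_of_pos (decide_eq_true h)

theorem restrict_cons_of_notMem (h : a ∉ S) : restrict S (a :: u) = restrict S u :=
  List.filter_cons_of_neg (by simpa using h)

theorem restrict_append : restrict S (u ++ v) = restrict S u ++ restrict S v :=
  List.filter_append _ _

theorem restrict_reverse : restrict S u.reverse = (restrict S u).reverse := List.filter_reverse

theorem mem_restrict : l ∈ restrict S u ↔ l ∈ u ∧ l ∈ S := by simp [restrict]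

theorem count_restrict (h : l ∈ S) : (restrict S u).count l = u.count l :=
  List.count_filter (decide_eq_true h)

theorem restrict_eq_self (h : u ⊆ S) : restrict S u = u :=
  List.filter_eq_self.2 fun _ hl => decide_eq_true (h hl)

theorem restrict_restrict (h : T ⊆ S) : restrict T (restrict S u) = restrict T u := by
  rw [restrict, restrict, List.filter_filter, restrict]
  refine List.filter_congr fun l _ => ?_
  rw [← Bool.decide_and, decide_eq_decide]
  exact and_iff_left_of_imp fun hl => h hl

theorem restrict_eq_of_subset (h : T ⊆ S) (huv : restrict S u = restrict S v) :
    restrict T u = restrict T v := by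
  rw [← restrict_restrict h, huv, restrict_restrict h]

theorem restrict_pair_comm : restrict [a, b] u = restrict [b, a] u :=
  List.filter_congr fun l _ => by simp [or_comm]

theorem flatMap_restrict {φ : α → List β} (h : ∀ l ∉ S, φ l = []) :
    (restrict S u).flatMap φ = u.flatMap φ := by
  induction u with
  | nil => rfl
  | cons a u ih =>
    by_cases ha : a ∈ S
    · rw [restrict_cons_of_mem ha, List.flatMap_cons, List.flatMap_cons, ih]
    · rw [restrict_cons_of_notMem ha, List.flatMap_cons, h a ha, ih, List.nil_append]

theorem restrict_eq_of_sublist (h : s.Sublist u) (hs : s ⊆ S)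
    (hc : ∀ l ∈ S, u.count l = s.count l) : restrict S u = s := by
  have h_sub : s.Sublist (restrict S u) := restrict_eq_self hs ▸ h.filter _
  refine (h_sub.eq_of_length (List.Perm.length_eq (List.perm_iff_count.2 fun l => ?_))).symm
  by_cases hl : l ∈ S
  · rw [count_restrict hl, hc l hl]
  · rw [List.count_eq_zero.2 fun h => hl (hs h),
      List.count_eq_zero.2 fun h => hl (mem_restrict.1 h).2]

/-- If the heads differed, then the head `c` of the first word would be preceded in the second one
by a letter `e ≠ c`, and the restrictions to `e` and `c` would have different heads. -/
theorem head_eq_of_restrict_consecutive (hc : c ∈ a :: u)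
    (hp : (a :: u).IsChain fun l l' => restrict [l, l'] (c :: v) = restrict [l, l'] (a :: u)) :
    c = a := by
  by_contra hca
  obtain ⟨p, e, q, h, hcp, hce⟩ :=
    exists_eq_append_cons_cons_of_ne_head (List.mem_of_ne_of_mem hca hc) hca
  rw [h] at hp
  have h_eq := (List.isChain_cons_cons.1 (List.isChain_append.1 hp).2.1).1
  rw [restrict_cons_of_mem (by simp), restrict_append, restrict_cons_of_mem (by simp), eq_comm,
    List.append_eq_cons_iff] at h_eq
  rcases h_eq with ⟨-, h_eq⟩ | ⟨p', h_eq, -⟩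
  · exact hce (List.cons.inj h_eq).1.symm
  · exact hcp (mem_restrict.1 (h_eq ▸ List.mem_cons_self)).1

theorem eq_of_restrict_consecutive (hc : ∀ l, v.count l = u.count l)
    (hp : u.IsChain fun l l' => restrict [l, l'] v = restrict [l, l'] u) : v = u := by
  induction u generalizing v with
  | nil => exact List.eq_nil_iff_forall_not_mem.2 fun l => List.count_eq_zero.1 (hc l)
  | cons a u ih =>
    rcases v with _ | ⟨c, v⟩
    · simpa using hc a
    obtain rfl : c = a := head_eq_of_restrict_consecutive
      (List.count_pos_iff.1 (by rw [← hc]; simp)) hp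
    congr 1
    refine ih (fun l => by simpa [List.count_cons] using hc l) (hp.tail.imp fun l l' hl => ?_)
    by_cases hy : c ∈ [l, l']
    · rw [restrict_cons_of_mem hy, restrict_cons_of_mem hy] at hl
      exact (List.cons.inj hl).2
    · rwa [restrict_cons_of_notMem hy, restrict_cons_of_notMem hy] at hl

end Restrict

/-! ### Patterns that make a frame rigid -/

/-- The factors of `w` that allow its factor monoid to recognise the order of letters in a frame: a
letter enclosed by another one, a letter before or after such a pattern, and two crossing ones. -/
structure HasPatterns (w : List Letter) : Prop where
  enclosed : ∃ (y : Letter) (s : List Letter), y ∉ s ∧ s ≠ [] ∧ [y] ++ s ++ [y] <:+: w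
  before : ∃ (c y : Letter) (s : List Letter), c ≠ y ∧ [c, y] ++ s ++ [y] <:+: w
  after : ∃ (c y : Letter) (s : List Letter), c ≠ y ∧ [y] ++ s ++ [y, c] <:+: w
  crossing : ∃ (y y' : Letter) (r s : List Letter),
    y ≠ y' ∧ [y] ++ r ++ [y', y] ++ s ++ [y'] <:+: w

theorem HasPatterns.reverse {w : List Letter} (h : HasPatterns w) : HasPatterns w.reverse where
  enclosed := by
    obtain ⟨y, s, hy, hs, hf⟩ := h.enclosed
    exact ⟨y, s.reverse, by simpa using hy, by simpa using hs,
      by simpa using List.reverse_infix.2 hf⟩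
  before := by
    obtain ⟨c, y, s, hc, hf⟩ := h.after
    exact ⟨c, y, s.reverse, hc, by simpa using List.reverse_infix.2 hf⟩
  after := by
    obtain ⟨c, y, s, hc, hf⟩ := h.before
    exact ⟨c, y, s.reverse, hc, by simpa using List.reverse_infix.2 hf⟩
  crossing := by
    obtain ⟨y, y', r, s, hy, hf⟩ := h.crossing
    exact ⟨y', y, s.reverse, r.reverse, hy.symm, by simpa using List.reverse_infix.2 hf⟩

theorem HasPatterns.ne_nil {w : List Letter} (h : HasPatterns w) : w ≠ [] := by
  rintro rfl
  obtain ⟨y, s, -, -, hf⟩ := h.enclosed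
  simp at hf

namespace IsIdentityOf

variable {w u v : List Letter}

theorem reverse (h : IsIdentityOf w u v) : IsIdentityOf w.reverse u.reverse v.reverse :=
  fun φ hφ => by
    have key (r : List Letter) :
        r.reverse.flatMap φ = (r.flatMap fun l => (φ l).reverse).reverse := by
      simp [List.reverse_flatMap, Function.comp_def]
    simp only [key, List.reverse_infix, List.reverse_inj] at hφ ⊢
    exact h _ hφ

theorem filter_ne (h : IsIdentityOf w u v) (l : Letter) :
    IsIdentityOf w (u.filter (· ≠ l)) (v.filter (· ≠ l)) := by
  have key (r : List Letter) : r.flatMap (fun a => if a = l then [] else [a]) =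
      r.filter (· ≠ l) := by
    induction r with
    | nil => rfl
    | cons a r ih => by_cases ha : a = l <;> simp [ha, ih]
  simpa only [key] using h.flatMap fun a => if a = l then [] else [a]

theorem subset (h : IsIdentityOf w u v) (hw : w ≠ []) : v ⊆ u := fun l hl => by
  by_contra hlu
  obtain ⟨c, -⟩ := List.exists_mem_of_ne_nil w hw
  have hu : u.flatMap (fun a => if a = l then [c] else []) = [] :=
    List.flatMap_eq_nil_iff.2 fun a ha => if_neg (ne_of_mem_of_not_mem ha hlu)
  have hv := h (fun a => if a = l then [c] else []) (Or.inl (by rw [hu]; exact List.nil_infix))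
  rw [hu, eq_comm, List.flatMap_eq_nil_iff] at hv
  simpa using hv l hl

end IsIdentityOf

theorem IsIdentityOf.flatMap_restrict_eq {w u v S r : List Letter} (h : IsIdentityOf w u v)
    {φ : Letter → List Letter} (hφ : ∀ l ∉ S, φ l = []) (hu : restrict S u = r)
    (hr : r.flatMap φ <:+: w) : (restrict S v).flatMap φ = r.flatMap φ := by
  have h_eq : u.flatMap φ = r.flatMap φ := by rw [← hu, flatMap_restrict hφ]
  rw [flatMap_restrict hφ, ← h φ (Or.inl (h_eq ▸ hr)), h_eq]

theorem eq_of_flatMap_eq_of_head?_injOn {α β : Type*} {S r r' : List α} {φ : α → List β}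
    (hne : ∀ l ∈ S, φ l ≠ []) (hinj : Set.InjOn (fun l => (φ l).head?) {l | l ∈ S}) (hr : r ⊆ S)
    (hr' : r' ⊆ S) (h : r.flatMap φ = r'.flatMap φ) : r = r' := by
  induction r generalizing r' with
  | nil =>
    rw [List.flatMap_nil, eq_comm, List.flatMap_eq_nil_iff] at h
    exact (List.eq_nil_iff_forall_not_mem.2 fun l hl => hne l (hr' hl) (h l hl)).symm
  | cons l r ih =>
    obtain ⟨hl, hr⟩ := List.cons_subset.1 hr
    rcases r' with _ | ⟨l', r'⟩
    · exact absurd (List.flatMap_eq_nil_iff.1 h l List.mem_cons_self) (hne l hl)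
    obtain ⟨hl', hr''⟩ := List.cons_subset.1 hr'
    simp only [List.flatMap_cons] at h
    obtain rfl : l = l' := hinj hl hl' <| by
      simpa [List.head?_append_of_ne_nil _ (hne l hl), List.head?_append_of_ne_nil _ (hne l' hl')]
        using congrArg List.head? h
    rw [ih hr hr'' (List.append_cancel_left h)]

section Patterns

variable {w u v : List Letter} {a b c : Letter}

theorem HasPatterns.restrict_eq_of_enclosed (hw : HasPatterns w) (h : IsIdentityOf w u v)
    (hab : a ≠ b) (hu : restrict [a, b] u = [a, b, a]) : restrict [a, b] v = [a, b, a] := by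
  obtain ⟨y, s, hy, hs, hf⟩ := hw.enclosed
  obtain ⟨d, s, rfl⟩ := List.exists_cons_of_ne_nil hs
  let φ : Letter → List Letter := fun l => if l = a then [y] else if l = b then d :: s else []
  have ha : φ a = [y] := if_pos rfl
  have hb : φ b = d :: s := by simp [φ, hab.symm]
  have hyd : y ≠ d := List.ne_of_not_mem_cons hy
  refine eq_of_flatMap_eq_of_head?_injOn (S := [a, b]) (φ := φ) (by simp [ha, hb]) ?_
    (fun _ hl => (mem_restrict.1 hl).2) (by simp)
    (h.flatMap_restrict_eq ?_ hu (by simpa [ha, hb] using hf))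
  · simp [Set.InjOn, ha, hb, hyd, hyd.symm]
  · intro l hl
    rw [List.mem_pair, not_or] at hl
    simp [φ, hl.1, hl.2]

theorem HasPatterns.restrict_eq_of_before (hw : HasPatterns w) (h : IsIdentityOf w u v)
    (hab : a ≠ b) (hca : c ≠ a) (hcb : c ≠ b) (hu : restrict [c, a, b] u = [c, a, b, a])
    (hc : v.count c = 1) : restrict [c, a, b] v = [c, a, b, a] := by
  have h_ab : restrict [a, b] (restrict [c, a, b] v) = [a, b, a] := by
    rw [restrict_restrict (by simp)]
    refine hw.restrict_eq_of_enclosed h hab ?_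
    rw [← restrict_restrict (List.subset_cons_self c _), hu,
      restrict_cons_of_notMem (by simp [hca, hcb]), restrict_eq_self (by simp)]
  rw [← count_restrict (S := [c, a, b]) List.mem_cons_self] at hc
  have h_sub : restrict [c, a, b] v ⊆ [c, a, b] := fun _ hl => (mem_restrict.1 hl).2
  obtain ⟨d, y, s, hdy, hf⟩ := hw.before
  let φ : Letter → List Letter := fun l =>
    if l = c then [d] else if l = a then [y] else if l = b then s else []
  have h_im : (restrict [c, a, b] v).flatMap φ = [c, a, b, a].flatMap φ := by
    refine h.flatMap_restrict_eq (fun l hl => ?_) hu ?_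
    · simp only [List.mem_cons, List.not_mem_nil, or_false, not_or] at hl
      simp [φ, hl]
    · simpa [φ, hca.symm, hcb.symm, hab.symm] using hf
  generalize restrict [c, a, b] v = r at *
  rcases r with _ | ⟨l, r⟩
  · simp at hc
  obtain ⟨hl, hr⟩ := List.cons_subset.1 h_sub
  simp only [List.mem_cons, List.not_mem_nil, or_false] at hl
  rcases hl with rfl | rfl | rfl
  · have hr' : r ⊆ [a, b] := fun l' hl' => (List.mem_cons.1 (hr hl')).resolve_left
      (ne_of_mem_of_not_mem hl' (by simpa [List.count_eq_zero] using hc))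
    rw [restrict_cons_of_notMem (by simp [hca, hcb]), restrict_eq_self hr'] at h_ab
    rw [h_ab]
  · have h_head : φ l = [y] := by simp [φ, hca.symm]
    have h_head' : φ c = [d] := by simp [φ]
    simp only [List.flatMap_cons, h_head, h_head'] at h_im
    exact absurd (List.cons.inj h_im).1.symm hdy
  · rw [restrict_cons_of_mem (by simp)] at h_ab
    exact absurd (List.cons.inj h_ab).1.symm hab

theorem HasPatterns.restrict_eq_of_after (hw : HasPatterns w) (h : IsIdentityOf w u v)
    (hab : a ≠ b) (hca : c ≠ a) (hcb : c ≠ b) (hu : restrict [c, a, b] u = [a, b, a, c])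
    (hc : v.count c = 1) : restrict [c, a, b] v = [a, b, a, c] := by
  have := hw.reverse.restrict_eq_of_before h.reverse hab hca hcb (by rw [restrict_reverse, hu]; rfl)
    (by rwa [List.count_reverse])
  rwa [restrict_reverse, List.reverse_eq_iff] at this

theorem exists_eq_cons_of_restrict {a s b t : Letter} {r : List Letter} (hr : r ⊆ [a, s, b, t])
    (has : a ≠ s) (hbs : b ≠ s) (hbt : b ≠ t) (h₁ : restrict [a, s] r = [a, s, a])
    (h₂ : restrict [b, t] r = [b, t, b]) (h₃ : restrict [b, s] r = [s, b, b]) :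
    ∃ r', r = a :: r' := by
  rcases r with _ | ⟨l, r⟩
  · cases h₁
  have hl := List.cons_subset.1 hr |>.1
  simp only [List.mem_cons, List.not_mem_nil, or_false] at hl
  rcases hl with rfl | rfl | rfl | rfl
  · exact ⟨r, rfl⟩
  · rw [restrict_cons_of_mem (by simp)] at h₁
    exact absurd (List.cons.inj h₁).1.symm has
  · rw [restrict_cons_of_mem (by simp)] at h₃
    exact absurd (List.cons.inj h₃).1 hbs
  · rw [restrict_cons_of_mem (by simp)] at h₂
    exact absurd (List.cons.inj h₂).1.symm hbt

theorem restrict_eq_or_eq_of_restrict_pairs {a s b t : Letter} {r : List Letter}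
    (hr : r ⊆ [a, s, b, t]) (has : a ≠ s) (hab : a ≠ b) (hbs : b ≠ s) (hat : a ≠ t) (hbt : b ≠ t)
    (h₁ : restrict [a, s] r = [a, s, a]) (h₂ : restrict [b, t] r = [b, t, b])
    (h₃ : restrict [b, s] r = [s, b, b]) (h₄ : restrict [a, t] r = [a, a, t]) :
    restrict [a, b] r = [a, a, b, b] ∨ restrict [a, b] r = [a, b, a, b] := by
  obtain ⟨p, rfl⟩ := exists_eq_cons_of_restrict hr has hbs hbt h₁ h₂ h₃
  obtain ⟨q, hq⟩ : ∃ q, (a :: p).reverse = b :: q := by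
    refine exists_eq_cons_of_restrict (a := b) (s := t) (b := a) (t := s) (fun l hl => ?_) hbt hat
      has (by rw [restrict_reverse, h₂]; rfl) (by rw [restrict_reverse, h₁]; rfl)
      (by rw [restrict_reverse, h₄]; rfl)
    have := hr (List.mem_reverse.1 hl)
    simp only [List.mem_cons] at this ⊢
    tauto
  have ha : (a :: p).count a = 2 := by
    rw [← count_restrict (S := [a, s]) (by simp), h₁]; simp [has.symm]
  have hb : (a :: p).count b = 2 := by
    rw [← count_restrict (S := [b, t]) (by simp), h₂]; simp [hbt.symm]
  rw [List.reverse_eq_cons_iff] at hq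
  obtain ⟨m, rfl⟩ : ∃ m, p = m ++ [b] := by
    rcases List.eq_nil_or_concat' p with rfl | ⟨m, c, rfl⟩
    · simp at ha
    · exact ⟨m, by rw [← List.cons_append] at hq; rw [(List.append_inj' hq rfl).2]⟩
  have h_mid : (restrict [a, b] m).Perm [a, b] := by
    refine List.perm_iff_count.2 fun l => ?_
    by_cases hl : l ∈ [a, b]
    · rw [count_restrict hl]
      rcases List.mem_pair.1 hl with rfl | rfl
      · simpa [hab.symm] using ha
      · simpa [hab] using hb
    · rw [List.count_eq_zero.2 hl, List.count_eq_zero.2 fun h => hl (mem_restrict.1 h).2]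
  rw [restrict_cons_of_mem (by simp), restrict_append]
  rcases List.perm_pair.1 h_mid with h | h <;> rw [h, restrict_eq_self (by simp)]
  · exact Or.inl rfl
  · exact Or.inr rfl

theorem count_eq_of_restrict_pairs {a s b t : Letter} {r : List Letter} (hr : r ⊆ [a, s, b, t])
    (hd : [a, s, b, t].Nodup) (h₁ : restrict [a, s] r = [a, s, a])
    (h₂ : restrict [b, t] r = [b, t, b]) (l : Letter) :
    r.count l = [a, s, a, b, t, b].count l := by
  rw [show [a, s, a, b, t, b] = [a, s, a] ++ [b, t, b] from rfl, List.count_append, ← h₁, ← h₂]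
  have h_disj : [a, s].Disjoint [b, t] := List.disjoint_of_nodup_append (l₁ := [a, s]) hd
  have h_zero {S : List Letter} (hl : l ∉ S) : (restrict S r).count l = 0 :=
    List.count_eq_zero.2 fun h => hl (mem_restrict.1 h).2
  by_cases has : l ∈ [a, s]
  · rw [count_restrict has, h_zero (h_disj has), Nat.add_zero]
  by_cases hbt : l ∈ [b, t]
  · rw [count_restrict hbt, h_zero has, Nat.zero_add]
  rw [h_zero has, h_zero hbt, List.count_eq_zero]
  exact fun hl => (List.mem_append (s := [a, s]).1 (hr hl)).elim has hbt

theorem eq_or_eq_of_restrict_pairs {a s b t : Letter} {r : List Letter} (hr : r ⊆ [a, s, b, t])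
    (hd : [a, s, b, t].Nodup) (h₁ : restrict [a, s] r = [a, s, a])
    (h₂ : restrict [b, t] r = [b, t, b]) (h₃ : restrict [b, s] r = [s, b, b])
    (h₄ : restrict [a, t] r = [a, a, t]) :
    r = [a, s, a, b, t, b] ∨ r = [a, s, b, a, t, b] := by
  have h_count := count_eq_of_restrict_pairs hr hd h₁ h₂
  have h_perm : [a, s, a, b, t, b].Perm [a, s, b, a, t, b] :=
    ((List.Perm.swap b a _).cons s).cons a
  simp only [List.nodup_cons, List.mem_cons, List.not_mem_nil, or_false, not_or] at hd
  obtain ⟨⟨has, hab, hat⟩, ⟨hsb, hst⟩, hbt, -⟩ := hd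
  refine (restrict_eq_or_eq_of_restrict_pairs hr has hab (Ne.symm hsb) hat hbt h₁ h₂ h₃ h₄).imp
    (fun h => eq_of_restrict_consecutive h_count ?_)
    fun h => eq_of_restrict_consecutive (fun l => (h_count l).trans (h_perm.count_eq l)) ?_
  · simp only [List.isChain_cons_cons, List.isChain_singleton, restrict_pair_comm (a := s) (b := a),
      restrict_pair_comm (a := t) (b := b), h₁, h₂, h]
    simp [restrict, has, hab, hat, hsb, hst, hbt, eq_comm]
  · simp only [List.isChain_cons_cons, List.isChain_singleton, restrict_pair_comm (a := s) (b := b),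
      restrict_pair_comm (a := b) (b := a), restrict_pair_comm (a := t) (b := b), h₁, h₂, h₃, h₄, h]
    simp [restrict, has, hab, hat, hsb, hst, hbt, eq_comm]

theorem HasPatterns.restrict_eq_of_crossing (hw : HasPatterns w) (h : IsIdentityOf w u v)
    {a s b t : Letter} (hd : [a, s, b, t].Nodup)
    (hu : restrict [a, s, b, t] u = [a, s, a, b, t, b] ∨
      restrict [a, s, b, t] u = [a, s, b, a, t, b])
    (h₁ : restrict [a, s] v = [a, s, a]) (h₂ : restrict [b, t] v = [b, t, b])
    (h₃ : restrict [b, s] v = [s, b, b]) (h₄ : restrict [a, t] v = [a, a, t]) :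
    restrict [a, s, b, t] v = restrict [a, s, b, t] u := by
  have hv := eq_or_eq_of_restrict_pairs (r := restrict [a, s, b, t] v)
    (fun _ hl => (mem_restrict.1 hl).2) hd (by rwa [restrict_restrict (by simp)])
    (by rwa [restrict_restrict (by simp)]) (by rwa [restrict_restrict (by simp)])
    (by rwa [restrict_restrict (by simp)])
  obtain ⟨y, y', p, q, hy, hf⟩ := hw.crossing
  let φ : Letter → List Letter := fun l =>
    if l = t then q else if l = b then [y'] else if l = s then p else if l = a then [y] else []
  have hφ : ∀ l ∉ [a, s, b, t], φ l = [] := fun l hl => by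
    simp only [List.mem_cons, List.not_mem_nil, or_false, not_or] at hl
    simp [φ, hl]
  simp only [List.nodup_cons, List.mem_cons, List.not_mem_nil, or_false, not_or] at hd
  have h_ne : [a, s, a, b, t, b].flatMap φ ≠ [a, s, b, a, t, b].flatMap φ := by
    simp [φ, hd, hy]
  have h_infix : [a, s, b, a, t, b].flatMap φ <:+: w := by simpa [φ, hd] using hf
  rcases hu with hu | hu <;> rcases hv with hv | hv
  · rw [hu, hv]
  · have := h.symm.flatMap_restrict_eq hφ hv h_infix
    exact absurd (hu ▸ this) h_ne
  · have := h.flatMap_restrict_eq hφ hu h_infix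
    exact absurd (hv ▸ this) h_ne
  · rw [hu, hv]

end Patterns

section Frames

variable {w v : List Letter} {A B Z : List ℕ} {i j : ℕ}

theorem filter_ne_x_sandwich {X₁ Y X₂ : List ℕ} :
    (sandwich A B X₁ Y X₂).filter (· ≠ Letter.x) = frame A B (zWord (X₁ ++ Y ++ X₂)) := by
  have key {s : List Letter} (hs : Letter.x ∉ s) : s.filter (· ≠ Letter.x) = s :=
    List.filter_eq_self.2 fun l hl => decide_eq_true (ne_of_mem_of_not_mem hl hs)
  simp only [sandwich_eq, List.filter_append, key x_notMem_zWord, key x_notMem_ztWord,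
    key x_notMem_tzWord]
  simp [frame]

theorem count_z_frame (hB : BlockBalanced A B Z) (hi : i ∈ Z) :
    (frame A B (zWord Z)).count (Letter.z i) = 2 := by
  have h_add := hB.count_add_count (i := i)
  have h_one := List.count_eq_one_of_mem hB.nodup hi
  simp only [frame, List.count_append, count_z_ztWord, count_z_zWord, count_z_tzWord]
  omega

theorem count_t_frame (hB : BlockBalanced A B Z) (hi : i ∈ Z) :
    (frame A B (zWord Z)).count (Letter.t i) = 1 := by
  have h_add := hB.count_add_count (i := i)
  have h_one := List.count_eq_one_of_mem hB.nodup hi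
  simp only [frame, List.count_append, count_t_ztWord, count_t_zWord, count_t_tzWord]
  omega

theorem mem_of_mem_frame (hB : BlockBalanced A B Z) {l : Letter} (hl : l ∈ frame A B (zWord Z)) :
    ∃ i ∈ Z, l = Letter.z i ∨ l = Letter.t i := by
  rcases l with _ | i | i
  · simp [frame] at hl
  · refine ⟨i, ?_, Or.inl rfl⟩
    simp only [frame, List.mem_append, z_mem_ztWord, z_mem_zWord, z_mem_tzWord] at hl
    rcases hl with (hl | hl) | hl
    exacts [hB.mem_iff.2 (Or.inl hl), hl, hB.mem_iff.2 (Or.inr hl)]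
  · exact ⟨i, by simpa [frame, hB.mem_iff] using hl, Or.inr rfl⟩

theorem sublist_pair_or_sublist_pair {α : Type*} {l : List α} {a b : α} (ha : a ∈ l) (hb : b ∈ l)
    (hab : a ≠ b) : [a, b].Sublist l ∨ [b, a].Sublist l := by
  obtain ⟨s, r, rfl⟩ := List.append_of_mem ha
  rcases List.mem_append.1 hb with hb | hb
  · exact Or.inr ((List.singleton_sublist.2 hb).append
      (List.singleton_sublist.2 List.mem_cons_self))
  · have hb := List.singleton_sublist.2 (List.mem_of_ne_of_mem hab.symm hb)
    exact Or.inl ((hb.cons_cons a).trans (List.sublist_append_right _ _))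

theorem sublist_frame {s₁ s₂ s₃ : List Letter} {I : List ℕ} (h₁ : s₁.Sublist (ztWord A))
    (hI : I.Sublist Z) (h₃ : s₃.Sublist (tzWord B)) (h₂ : zWord I = s₂) :
    (s₁ ++ s₂ ++ s₃).Sublist (frame A B (zWord Z)) :=
  (h₁.append (h₂ ▸ hI.map Letter.z)).append h₃

theorem ztWord_sublist {I : List ℕ} (h : I.Sublist A) : (ztWord I).Sublist (ztWord A) := h.flatMap _

theorem tzWord_sublist {I : List ℕ} (h : I.Sublist B) : (tzWord I).Sublist (tzWord B) := h.flatMap _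

theorem frame_sublist_cases (hB : BlockBalanced A B Z) (hi : i ∈ A) (hj : j ∈ Z) :
    [Letter.z i, Letter.t j, Letter.z i].Sublist (frame A B (zWord Z)) ∨
    i ≠ j ∧ [Letter.t j, Letter.z i, Letter.t i, Letter.z i].Sublist (frame A B (zWord Z)) ∨
    i ≠ j ∧ [Letter.z i, Letter.t i, Letter.z i, Letter.t j].Sublist (frame A B (zWord Z)) := by
  have hiZ : [i].Sublist Z := List.singleton_sublist.2 (hB.mem_iff.2 (Or.inl hi))
  have h_zt := ztWord_sublist (List.singleton_sublist.2 hi)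
  by_cases hij : i = j
  · subst hij
    exact Or.inl (sublist_frame h_zt hiZ (List.nil_sublist _) rfl)
  rcases hB.mem_iff.1 hj with hj | hj
  · rcases sublist_pair_or_sublist_pair hi hj hij with h | h
    · refine Or.inl (sublist_frame (s₁ := [Letter.z i, Letter.t j]) ?_ hiZ (List.nil_sublist _) rfl)
      exact List.Sublist.trans (by simp) (ztWord_sublist h)
    · refine Or.inr (Or.inl ⟨hij, sublist_frame (s₁ := [Letter.t j, Letter.z i, Letter.t i])
        ?_ hiZ (List.nil_sublist _) rfl⟩)
      exact List.Sublist.trans (by simp) (ztWord_sublist h)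
  · refine Or.inr (Or.inr ⟨hij, sublist_frame h_zt hiZ (s₃ := [Letter.t j]) ?_ rfl⟩)
    exact List.singleton_sublist.2 (t_mem_tzWord.2 hj)

theorem restrict_frame_cases_of_mem_left (hB : BlockBalanced A B Z) (hi : i ∈ A) (hj : j ∈ Z) :
    restrict [Letter.z i, Letter.t j] (frame A B (zWord Z)) =
      [Letter.z i, Letter.t j, Letter.z i] ∨
    i ≠ j ∧ restrict [Letter.t j, Letter.z i, Letter.t i] (frame A B (zWord Z)) =
      [Letter.t j, Letter.z i, Letter.t i, Letter.z i] ∨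
    i ≠ j ∧ restrict [Letter.t j, Letter.z i, Letter.t i] (frame A B (zWord Z)) =
      [Letter.z i, Letter.t i, Letter.z i, Letter.t j] := by
  have hiZ := hB.mem_iff.2 (Or.inl hi)
  refine (frame_sublist_cases hB hi hj).imp (fun h => ?_) (Or.imp (fun h => ⟨h.1, ?_⟩)
    fun h => ⟨h.1, ?_⟩)
  · exact restrict_eq_of_sublist h (by simp) (by simp [count_z_frame hB hiZ, count_t_frame hB hj])
  · exact restrict_eq_of_sublist h.2 (by simp) (by
      simp [count_z_frame hB hiZ, count_t_frame hB hiZ, count_t_frame hB hj, h.1, Ne.symm h.1])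
  · exact restrict_eq_of_sublist h.2 (by simp) (by
      simp [count_z_frame hB hiZ, count_t_frame hB hiZ, count_t_frame hB hj, h.1, Ne.symm h.1])

theorem restrict_frame_cases (hB : BlockBalanced A B Z) (hi : i ∈ Z) (hj : j ∈ Z) :
    restrict [Letter.z i, Letter.t j] (frame A B (zWord Z)) =
      [Letter.z i, Letter.t j, Letter.z i] ∨
    i ≠ j ∧ restrict [Letter.t j, Letter.z i, Letter.t i] (frame A B (zWord Z)) =
      [Letter.t j, Letter.z i, Letter.t i, Letter.z i] ∨
    i ≠ j ∧ restrict [Letter.t j, Letter.z i, Letter.t i] (frame A B (zWord Z)) =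
      [Letter.z i, Letter.t i, Letter.z i, Letter.t j] := by
  rcases hB.mem_iff.1 hi with hiA | hiB
  · exact restrict_frame_cases_of_mem_left hB hiA hj
  · have h := restrict_frame_cases_of_mem_left hB.reverse (List.mem_reverse.2 hiB)
      (List.mem_reverse.2 hj)
    simp only [← reverse_zWord, ← reverse_frame, restrict_reverse, List.reverse_eq_iff] at h
    exact h.imp id Or.symm

theorem restrict_zt_self (hB : BlockBalanced A B Z) (hw : HasPatterns w)
    (h : IsIdentityOf w (frame A B (zWord Z)) v) (hi : i ∈ Z) :
    restrict [Letter.z i, Letter.t i] v = [Letter.z i, Letter.t i, Letter.z i] := by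
  refine hw.restrict_eq_of_enclosed h (by simp) ?_
  simpa using restrict_frame_cases hB hi hi

theorem count_eq_of_isIdentityOf_frame (hB : BlockBalanced A B Z) (hw : HasPatterns w)
    (h : IsIdentityOf w (frame A B (zWord Z)) v) (l : Letter) :
    v.count l = (frame A B (zWord Z)).count l := by
  by_cases hl : l ∈ frame A B (zWord Z)
  · obtain ⟨i, hi, rfl | rfl⟩ := mem_of_mem_frame hB hl <;>
      rw [← count_restrict (S := [Letter.z i, Letter.t i]) (by simp), restrict_zt_self hB hw h hi]
    · simp [count_z_frame hB hi]
    · simp [count_t_frame hB hi]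
  · rw [List.count_eq_zero.2 hl, List.count_eq_zero.2 fun hv => hl (h.subset hw.ne_nil hv)]

theorem restrict_zt (hB : BlockBalanced A B Z) (hw : HasPatterns w)
    (h : IsIdentityOf w (frame A B (zWord Z)) v) (hi : i ∈ Z) (hj : j ∈ Z) :
    restrict [Letter.z i, Letter.t j] v =
      restrict [Letter.z i, Letter.t j] (frame A B (zWord Z)) := by
  have hc : v.count (Letter.t j) = 1 :=
    (count_eq_of_isIdentityOf_frame hB hw h _).trans (count_t_frame hB hj)
  rcases restrict_frame_cases hB hi hj with hf | ⟨hij, hf⟩ | ⟨hij, hf⟩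
  · rw [hf, hw.restrict_eq_of_enclosed h (by simp) hf]
  · refine restrict_eq_of_subset (by simp) (Eq.trans ?_ hf.symm)
    exact hw.restrict_eq_of_before h (by simp) (by simp) (by simpa using hij.symm) hf hc
  · refine restrict_eq_of_subset (by simp) (Eq.trans ?_ hf.symm)
    exact hw.restrict_eq_of_after h (by simp) (by simp) (by simpa using hij.symm) hf hc

theorem restrict_frame_crossing (hB : BlockBalanced A B Z) (hi : i ∈ A) (hj : j ∈ B) :
    restrict [Letter.z i, Letter.t i, Letter.z j, Letter.t j] (frame A B (zWord Z)) =
      [Letter.z i, Letter.t i, Letter.z i, Letter.z j, Letter.t j, Letter.z j] ∨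
    restrict [Letter.z i, Letter.t i, Letter.z j, Letter.t j] (frame A B (zWord Z)) =
      [Letter.z i, Letter.t i, Letter.z j, Letter.z i, Letter.t j, Letter.z j] := by
  have hij : i ≠ j := fun hij => hB.disjoint hi (hij ▸ hj)
  have hiZ := hB.mem_iff.2 (Or.inl hi)
  have hjZ := hB.mem_iff.2 (Or.inr hj)
  have h_zt := ztWord_sublist (List.singleton_sublist.2 hi)
  have h_tz := tzWord_sublist (List.singleton_sublist.2 hj)
  refine (sublist_pair_or_sublist_pair hiZ hjZ hij).imp (fun h => ?_) fun h => ?_ <;>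
  · refine restrict_eq_of_sublist (sublist_frame h_zt h h_tz rfl) (by simp) ?_
    simp [count_z_frame hB, count_t_frame hB, hiZ, hjZ, hij, hij.symm]

theorem restrict_zz (hB : BlockBalanced A B Z) (hw : HasPatterns w)
    (h : IsIdentityOf w (frame A B (zWord Z)) v) (hi : i ∈ A) (hj : j ∈ B) :
    restrict [Letter.z i, Letter.z j] v =
      restrict [Letter.z i, Letter.z j] (frame A B (zWord Z)) := by
  have hij : i ≠ j := fun hij => hB.disjoint hi (hij ▸ hj)
  have hiZ := hB.mem_iff.2 (Or.inl hi)
  have hjZ := hB.mem_iff.2 (Or.inr hj)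
  have hf := restrict_frame_crossing hB hi hj
  suffices h_quad : restrict [Letter.z i, Letter.t i, Letter.z j, Letter.t j] v =
      restrict [Letter.z i, Letter.t i, Letter.z j, Letter.t j] (frame A B (zWord Z)) from
    restrict_eq_of_subset (by simp) h_quad
  have key {T r : List Letter} (hT : T ⊆ [Letter.z i, Letter.t i, Letter.z j, Letter.t j])
      (hr : ∀ s ∈ [[Letter.z i, Letter.t i, Letter.z i, Letter.z j, Letter.t j, Letter.z j],
        [Letter.z i, Letter.t i, Letter.z j, Letter.z i, Letter.t j, Letter.z j]],
        restrict T s = r) : restrict T (frame A B (zWord Z)) = r := by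
    rw [← restrict_restrict hT]
    exact hr _ (by simpa using hf)
  refine hw.restrict_eq_of_crossing h (by simp [hij]) hf (restrict_zt_self hB hw h hiZ)
    (restrict_zt_self hB hw h hjZ) ?_ ?_
  · rw [restrict_zt hB hw h hjZ hiZ]
    exact key (by simp) (by simp [restrict, hij, hij.symm])
  · rw [restrict_zt hB hw h hiZ hjZ]
    exact key (by simp) (by simp [restrict, hij, hij.symm])

theorem isChain_ztWord_append {R : Letter → Letter → Prop} {c : List Letter}
    (hR : ∀ i ∈ Z, ∀ j ∈ Z, R (Letter.z i) (Letter.t j) ∧ R (Letter.t j) (Letter.z i))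
    (hA : A ⊆ Z) (hc : ∀ l ∈ c.head?, ∃ i ∈ Z, l = Letter.z i) (h : c.IsChain R) :
    (ztWord A ++ c).IsChain R := by
  induction A with
  | nil => exact h
  | cons i A ih =>
    obtain ⟨hi, hA⟩ := List.cons_subset.1 hA
    simp only [ztWord_cons, List.cons_append, List.isChain_cons_cons]
    refine ⟨(hR i hi i hi).1, List.isChain_cons.2 ⟨fun l hl => ?_, ih hA⟩⟩
    obtain ⟨j, hj, rfl⟩ : ∃ j ∈ Z, l = Letter.z j := by
      rcases A with _ | ⟨j, A⟩
      · exact hc l hl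
      · exact ⟨j, hA List.mem_cons_self, (Option.mem_some.1 hl).symm⟩
    exact (hR j hj i hi).2

theorem isChain_frame {R : Letter → Letter → Prop}
    (hR : ∀ i ∈ Z, ∀ j ∈ Z, R (Letter.z i) (Letter.t j) ∧ R (Letter.t j) (Letter.z i))
    (hA : A ⊆ Z) (hB : B ⊆ Z) (hZ : (zWord Z).IsChain R) : (frame A B (zWord Z)).IsChain R := by
  have h_right : (zWord Z ++ tzWord B).IsChain R := by
    rw [← List.reverse_reverse (zWord Z ++ tzWord B), List.isChain_reverse, List.reverse_append,
      reverse_tzWord, reverse_zWord]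
    refine isChain_ztWord_append (Z := Z) (fun i hi j hj => (hR i hi j hj).symm)
      (fun i hi => hB (List.mem_reverse.1 hi)) (fun l hl => ?_) ?_
    · obtain ⟨i, hi, rfl⟩ := List.mem_map.1 (List.mem_of_mem_head? hl)
      exact ⟨i, List.mem_reverse.1 hi, rfl⟩
    · rwa [← reverse_zWord, List.isChain_reverse]
  rw [frame, List.append_assoc]
  refine isChain_ztWord_append hR hA (fun l hl => ?_) h_right
  rcases Z with _ | ⟨i, Z⟩
  · simp [List.subset_nil.1 hB] at hl
  · exact ⟨i, List.mem_cons_self, (Option.mem_some.1 hl).symm⟩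

/-- Of two consecutive letters of the main block, one comes from each side of the frame. -/
def IsAlternating (A B Z : List ℕ) : Prop :=
  Z.IsChain fun i j => i ∈ A ∧ j ∈ B ∨ i ∈ B ∧ j ∈ A

theorem IsAlternating.reverse (h : IsAlternating A B Z) :
    IsAlternating B.reverse A.reverse Z.reverse := by
  rw [IsAlternating, List.isChain_reverse]
  refine h.imp fun i j hij => ?_
  simpa only [flip, List.mem_reverse, and_comm] using hij

theorem eq_frame_of_isIdentityOf (hB : BlockBalanced A B Z) (hZ : IsAlternating A B Z)
    (hw : HasPatterns w) (h : IsIdentityOf w (frame A B (zWord Z)) v) :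
    v = frame A B (zWord Z) := by
  refine eq_of_restrict_consecutive (count_eq_of_isIdentityOf_frame hB hw h) ?_
  refine isChain_frame (fun i hi j hj => ⟨restrict_zt hB hw h hi hj, ?_⟩)
    (fun i hi => hB.mem_iff.2 (Or.inl hi)) (fun i hi => hB.mem_iff.2 (Or.inr hi)) ?_
  · rw [restrict_pair_comm, restrict_zt hB hw h hi hj, restrict_pair_comm]
  · refine List.isChain_map_of_isChain _ (fun i j hij => ?_) hZ
    rcases hij with ⟨hi, hj⟩ | ⟨hi, hj⟩
    · exact restrict_zz hB hw h hi hj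
    · rw [restrict_pair_comm, restrict_zz hB hw h hj hi, restrict_pair_comm]

end Frames

/-! ### Identities that move the letter `x` -/

/-- The substitution that renames the indices of letters, erasing those sent to `none`. -/
def renameLetter (π : ℕ → Option ℕ) : Letter → List Letter
  | Letter.x => [Letter.x]
  | Letter.z i => ((π i).map Letter.z).toList
  | Letter.t i => ((π i).map Letter.t).toList

section Renaming

variable {π : ℕ → Option ℕ} {A B X₁ Y X₂ Z : List ℕ}

theorem flatMap_renameLetter_zWord :
    (zWord Z).flatMap (renameLetter π) = zWord (Z.filterMap π) := by
  induction Z with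
  | nil => rfl
  | cons i Z ih => rcases h : π i with _ | j <;> simp [ih, renameLetter, h]

theorem flatMap_renameLetter_ztWord :
    (ztWord Z).flatMap (renameLetter π) = ztWord (Z.filterMap π) := by
  induction Z with
  | nil => rfl
  | cons i Z ih => rcases h : π i with _ | j <;> simp [ih, renameLetter, h]

theorem flatMap_renameLetter_tzWord :
    (tzWord Z).flatMap (renameLetter π) = tzWord (Z.filterMap π) := by
  induction Z with
  | nil => rfl
  | cons i Z ih => rcases h : π i with _ | j <;> simp [ih, renameLetter, h]

theorem flatMap_renameLetter_sandwich : (sandwich A B X₁ Y X₂).flatMap (renameLetter π) =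
    sandwich (A.filterMap π) (B.filterMap π) (X₁.filterMap π) (Y.filterMap π)
      (X₂.filterMap π) := by
  simp [sandwich_eq, flatMap_renameLetter_zWord, flatMap_renameLetter_ztWord,
    flatMap_renameLetter_tzWord, renameLetter]

theorem restrict_eq_of_renameLetter {w u v : List Letter} (h : IsIdentityOf w u v) {i j : ℕ}
    (hi : ∀ k, π k = some j ↔ k = i) (hu : u.flatMap (renameLetter π) <:+: w) :
    restrict [Letter.x, Letter.z i] v = restrict [Letter.x, Letter.z i] u := by
  let ψ : Letter → List Letter := fun l =>
    if l = Letter.x then [Letter.x] else if l = Letter.z j then [Letter.z i] else []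
  let φ : Letter → List Letter := fun l => (renameLetter π l).flatMap ψ
  have hφx : φ Letter.x = [Letter.x] := by simp [φ, renameLetter, ψ]
  have hφi : φ (Letter.z i) = [Letter.z i] := by simp [φ, renameLetter, (hi i).2 rfl, ψ]
  have hφ : ∀ l ∉ [Letter.x, Letter.z i], φ l = [] := by
    rintro (_ | k | k) hl
    · exact absurd List.mem_cons_self hl
    · have hk : π k ≠ some j := fun hk => hl (by simp [(hi k).1 hk])
      rcases hm : π k with _ | m
      · simp [φ, renameLetter, hm]
      · have hmj : m ≠ j := fun hmj => hk (hmj ▸ hm)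
        simp [φ, renameLetter, hm, ψ, hmj]
    · rcases hm : π k with _ | m <;> simp [φ, renameLetter, hm, ψ]
  have h_restrict (r : List Letter) :
      restrict [Letter.x, Letter.z i] r = (r.flatMap (renameLetter π)).flatMap ψ := by
    rw [List.flatMap_assoc, ← flatMap_restrict (φ := φ) hφ]
    refine ((List.flatMap_congr fun l hl => ?_).trans (List.flatMap_singleton' _)).symm
    rcases List.mem_pair.1 (mem_restrict.1 hl).2 with rfl | rfl
    exacts [hφx, hφi]
  rw [h_restrict, h_restrict, h _ (Or.inl hu)]

end Renaming

theorem exists_append_of_count_eq_two {α : Type*} [DecidableEq α] {l : α} {v : List α}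
    (h : v.count l = 2) : ∃ a b c, v = a ++ l :: (b ++ l :: c) ∧ l ∉ a ∧ l ∉ b ∧ l ∉ c := by
  obtain ⟨a, r, rfl, ha⟩ := List.eq_append_cons_of_mem
    (List.count_pos_iff.1 (h ▸ Nat.two_pos : 0 < v.count l))
  have h_one : r.count l = 1 := by simpa [List.count_eq_zero.2 ha] using h
  obtain ⟨b, c, rfl, hb⟩ := List.eq_append_cons_of_mem
    (List.count_pos_iff.1 (h_one ▸ Nat.one_pos : 0 < r.count l))
  have h_zero : c.count l = 0 := by simpa [List.count_eq_zero.2 hb] using h_one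
  exact ⟨a, b, c, rfl, ha, hb, List.count_eq_zero.1 h_zero⟩

theorem mem_between_iff_of_restrict_eq {α : Type*} [DecidableEq α] {l a : α}
    {u₁ u₂ u₃ v₁ v₂ v₃ : List α} (hu₁ : l ∉ u₁) (hu₂ : l ∉ u₂) (hv₁ : l ∉ v₁) (hv₂ : l ∉ v₂)
    (h : restrict [l, a] (u₁ ++ l :: (u₂ ++ l :: u₃)) =
      restrict [l, a] (v₁ ++ l :: (v₂ ++ l :: v₃))) : a ∈ u₂ ↔ a ∈ v₂ := by
  have h_notMem {s : List α} (hs : l ∉ s) : l ∉ restrict [l, a] s :=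
    fun hl => hs (mem_restrict.1 hl).1
  have hl : l ∈ [l, a] := List.mem_cons_self
  simp only [restrict_append, restrict_cons_of_mem hl] at h
  obtain ⟨-, h_right⟩ := append_cons_inj_of_notMem_left (h_notMem hu₁) (h_notMem hv₁) h
  obtain ⟨h_between, -⟩ := append_cons_inj_of_notMem_left (h_notMem hu₂) (h_notMem hv₂) h_right
  have ha {s : List α} : a ∈ restrict [l, a] s ↔ a ∈ s := by simp [mem_restrict]
  rw [← ha, h_between, ha]

section MoveX

variable {w v V₁ V₂ V₃ : List Letter} {A B X₁ Y X₂ : List ℕ} {i j : ℕ}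

theorem mem_between_iff_of_restrict_sandwich_eq {l : Letter} (hV₁ : Letter.x ∉ V₁)
    (hV₂ : Letter.x ∉ V₂) (h : restrict [Letter.x, l] (V₁ ++ Letter.x :: (V₂ ++ Letter.x :: V₃)) =
      restrict [Letter.x, l] (sandwich A B X₁ Y X₂)) : l ∈ V₂ ↔ l ∈ zWord Y := by
  have h_eq : sandwich A B X₁ Y X₂ = (ztWord A ++ zWord X₁) ++
      Letter.x :: (zWord Y ++ Letter.x :: (zWord X₂ ++ tzWord B)) := by simp [sandwich_eq]
  exact mem_between_iff_of_restrict_eq hV₁ hV₂ (u₁ := V₁) (v₁ := ztWord A ++ zWord X₁) (by simp)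
    x_notMem_zWord (h.trans (by rw [h_eq]))

theorem t_notMem_between (hw : HasPatterns w) (hB : BlockBalanced A B (X₁ ++ Y ++ X₂))
    (h : IsIdentityOf w (sandwich A B X₁ Y X₂) (V₁ ++ Letter.x :: (V₂ ++ Letter.x :: V₃)))
    (hV : V₁ ++ V₂ ++ V₃ = frame A B (zWord (X₁ ++ Y ++ X₂)))
    (hx : (V₁ ++ Letter.x :: (V₂ ++ Letter.x :: V₃)).count Letter.x = 2)
    (hV₁ : Letter.x ∉ V₁) (hV₂ : Letter.x ∉ V₂) (i : ℕ) : Letter.t i ∉ V₂ := fun hi => by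
  have hiZ : i ∈ X₁ ++ Y ++ X₂ := by
    obtain ⟨k, hk, hik⟩ := mem_of_mem_frame hB (l := Letter.t i) (by rw [← hV]; simp [hi])
    obtain rfl : i = k := by simpa using hik
    exact hk
  have ht : (V₁ ++ Letter.x :: (V₂ ++ Letter.x :: V₃)).count (Letter.t i) = 1 := by
    rw [← count_t_frame hB hiZ, ← hV]
    simp
  have h_restrict : restrict [Letter.x, Letter.t i] (V₁ ++ Letter.x :: (V₂ ++ Letter.x :: V₃)) =
      [Letter.x, Letter.t i, Letter.x] := by
    refine restrict_eq_of_sublist ?_ (by simp) ?_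
    · exact (((List.singleton_sublist.2 hi).append
        ((List.nil_sublist V₃).cons_cons Letter.x)).cons_cons Letter.x).trans
          (List.sublist_append_right V₁ _)
    · intro l hl
      rcases List.mem_pair.1 hl with rfl | rfl
      · simpa using hx
      · simpa using ht
  exact t_notMem_zWord ((mem_between_iff_of_restrict_sandwich_eq hV₁ hV₂ (h_restrict.trans
    (hw.restrict_eq_of_enclosed h.symm (by simp) h_restrict).symm)).1 hi)

theorem exists_eq_sandwich_of_isIdentityOf (hw : HasPatterns w)
    (hB : BlockBalanced A B (X₁ ++ Y ++ X₂)) (hZ : IsAlternating A B (X₁ ++ Y ++ X₂))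
    (h : IsIdentityOf w (sandwich A B X₁ Y X₂) v) (hi : i ∈ Y) (hj : j ∈ Y) (hij : i ≠ j)
    (hvi : restrict [Letter.x, Letter.z i] v =
      restrict [Letter.x, Letter.z i] (sandwich A B X₁ Y X₂))
    (hvj : restrict [Letter.x, Letter.z j] v =
      restrict [Letter.x, Letter.z j] (sandwich A B X₁ Y X₂)) :
    ∃ X₁' Y' X₂', X₁' ++ Y' ++ X₂' = X₁ ++ Y ++ X₂ ∧ i ∈ Y' ∧ j ∈ Y' ∧
      v = sandwich A B X₁' Y' X₂' := by
  have h_frame : v.filter (· ≠ Letter.x) = frame A B (zWord (X₁ ++ Y ++ X₂)) :=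
    eq_frame_of_isIdentityOf hB hZ hw (filter_ne_x_sandwich ▸ h.filter_ne Letter.x)
  have hx : v.count Letter.x = 2 := by
    rw [← count_restrict (S := [Letter.x, Letter.z i]) (by simp), hvi,
      count_restrict (by simp), sandwich_eq]
    simp
  obtain ⟨V₁, V₂, V₃, rfl, hV₁, hV₂, hV₃⟩ := exists_append_of_count_eq_two hx
  have h_filter {s : List Letter} (hs : Letter.x ∉ s) : s.filter (· ≠ Letter.x) = s :=
    List.filter_eq_self.2 fun l hl => decide_eq_true (ne_of_mem_of_not_mem hl hs)
  have hV : V₁ ++ V₂ ++ V₃ = frame A B (zWord (X₁ ++ Y ++ X₂)) := by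
    rw [← h_frame, List.filter_append, List.filter_cons_of_neg (by simp), List.filter_append,
      List.filter_cons_of_neg (by simp), h_filter hV₁, h_filter hV₂, h_filter hV₃,
      List.append_assoc]
  have hiV : Letter.z i ∈ V₂ :=
    (mem_between_iff_of_restrict_sandwich_eq hV₁ hV₂ hvi).2 (z_mem_zWord.2 hi)
  have hjV : Letter.z j ∈ V₂ :=
    (mem_between_iff_of_restrict_sandwich_eq hV₁ hV₂ hvj).2 (z_mem_zWord.2 hj)
  have h_length : 2 ≤ V₂.length :=
    (List.subperm_of_subset (l₁ := [Letter.z i, Letter.z j]) (by simpa using hij)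
      (by simp [hiV, hjV])).length_le
  obtain ⟨s₁, s₂, rfl, rfl, h_block⟩ := exists_eq_of_append_eq_frame hV
    (t_notMem_between hw hB h hV hx hV₁ hV₂) h_length
  obtain ⟨L, X₂', hL, hL', rfl⟩ := List.map_eq_append_iff.1 h_block
  obtain ⟨X₁', Y', rfl, rfl, rfl⟩ := List.map_eq_append_iff.1 hL'
  exact ⟨X₁', Y', X₂', hL.symm, by simpa using hiV, by simpa using hjV,
    by simp [sandwich_eq, zWord]⟩

end MoveX

/-- The index `i` marks its place in the main block `Z`: some renaming of the sandwich word to `w`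
keeps the letters with index `i` and erases those with an index in `N`, so that an identity of the
factor monoid of `w` cannot move `x` across `z i`. -/
def IsMarker (w : List Letter) (A B Z N : List ℕ) (i : ℕ) : Prop :=
  ∃ π : ℕ → Option ℕ, (∃ j, ∀ k, π k = some j ↔ k = i) ∧ (∀ k ∈ N, π k = none) ∧
    sandwich (A.filterMap π) (B.filterMap π) [] (Z.filterMap π) [] = w

namespace IsMarker

variable {w v : List Letter} {A B Z N X₁ Y X₂ : List ℕ} {i : ℕ}

theorem reverse (h : IsMarker w A B Z N i) :
    IsMarker w.reverse B.reverse A.reverse Z.reverse N.reverse i := by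
  obtain ⟨π, hi, hN, rfl⟩ := h
  refine ⟨π, hi, fun k hk => hN k (List.mem_reverse.1 hk), ?_⟩
  simp only [reverse_sandwich, List.filterMap_reverse, List.reverse_nil]

theorem restrict_eq (hm : IsMarker w A B (X₁ ++ Y ++ X₂) N i) (h₁ : X₁ ⊆ N) (h₂ : X₂ ⊆ N)
    (h : IsIdentityOf w (sandwich A B X₁ Y X₂) v) :
    restrict [Letter.x, Letter.z i] v =
      restrict [Letter.x, Letter.z i] (sandwich A B X₁ Y X₂) := by
  obtain ⟨π, ⟨j, hi⟩, hN, rfl⟩ := hm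
  have h_nil₁ : X₁.filterMap π = [] := List.filterMap_eq_nil_iff.2 fun k hk => hN k (h₁ hk)
  have h_nil₂ : X₂.filterMap π = [] := List.filterMap_eq_nil_iff.2 fun k hk => hN k (h₂ hk)
  refine restrict_eq_of_renameLetter h hi ?_
  simp only [flatMap_renameLetter_sandwich, List.filterMap_append, h_nil₁, h_nil₂,
    List.nil_append, List.append_nil, List.infix_rfl]

end IsMarker

theorem IsClosedUnderIdentitiesOf.reverse {w : List Letter} {L : Set (List Letter)}
    (h : IsClosedUnderIdentitiesOf w L) :
    IsClosedUnderIdentitiesOf w.reverse (List.reverse ⁻¹' L) := fun _ _ hu huv =>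
  h _ _ hu (by simpa using huv.reverse)

theorem IsSyntacticIdentityOf.reverse {u v : List Letter} {L : Set (List Letter)}
    (h : IsSyntacticIdentityOf L u v) :
    IsSyntacticIdentityOf (List.reverse ⁻¹' L) u.reverse v.reverse := fun φ p q => by
  simpa [List.reverse_flatMap, Function.comp_def] using
    h (fun l => (φ l).reverse) q.reverse p.reverse

theorem exists_append_eq_of_mem_right {α : Type*} {X Y P I : List α} {c : α}
    (hnd : (P ++ c :: I).Nodup) (h : X ++ Y = P ++ c :: I) (hc : c ∈ Y) :
    ∃ P₂, X ++ P₂ = P ∧ Y = P₂ ++ c :: I := by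
  rcases List.append_eq_append_iff.1 h with ⟨P₂, rfl, rfl⟩ | ⟨_ | ⟨d, X'⟩, rfl, hI⟩
  · exact ⟨P₂, rfl, rfl⟩
  · exact ⟨[], by simp, hI.symm⟩
  · obtain ⟨rfl, rfl⟩ := List.cons.inj hI
    simp [List.nodup_append, hc] at hnd

/-- The words that arise from the sandwich word with main block `x P Q x` by moving the second `x`
inside `Q`. -/
def rightLanguage (A B P Q : List ℕ) : Set (List Letter) :=
  {u | ∃ Q₁ Q₂, Q₁ ++ Q₂ = Q ∧ u = sandwich A B [] (P ++ Q₁) Q₂}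

section Languages

variable {w : List Letter} {A B P Q P' Q' Z J : List ℕ} {c d : ℕ}

theorem isClosedUnderIdentitiesOf_leftLanguage (hw : HasPatterns w)
    (hB : BlockBalanced A B (P ++ c :: (J ++ [d]))) (hZ : IsAlternating A B (P ++ c :: (J ++ [d])))
    (hc : IsMarker w A B (P ++ c :: (J ++ [d])) P c)
    (hd : IsMarker w A B (P ++ c :: (J ++ [d])) P d) :
    IsClosedUnderIdentitiesOf w (leftLanguage A B P (c :: (J ++ [d]))) := by
  rintro _ v ⟨P₁, P₂, hP, rfl⟩ h
  have h_block : P ++ c :: (J ++ [d]) = P₁ ++ (P₂ ++ c :: (J ++ [d])) ++ [] := by simp [← hP]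
  have hP₁ : P₁ ⊆ P := hP ▸ List.subset_append_left P₁ P₂
  have hnd := hB.nodup
  have hcd : c ≠ d := by
    rintro rfl
    simp [List.nodup_append] at hnd
  rw [h_block] at hB hZ hc hd
  obtain ⟨X₁, Y, X₂, h_eq, hcY, hdY, rfl⟩ := exists_eq_sandwich_of_isIdentityOf hw hB hZ h
    (by simp) (by simp) hcd (hc.restrict_eq hP₁ (List.nil_subset P) h)
    (hd.restrict_eq hP₁ (List.nil_subset P) h)
  rw [← h_block] at h_eq
  obtain ⟨R, hR, -⟩ := exists_append_eq_of_mem_right (X := X₂.reverse) (P := [])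
    (I := J.reverse ++ c :: P.reverse) (by simpa using List.nodup_reverse.2 hnd)
    (by simpa using congrArg List.reverse h_eq) (List.mem_reverse.2 (List.mem_append_right X₁ hdY))
  obtain rfl : X₂ = [] := List.reverse_eq_nil_iff.1 (List.append_eq_nil_iff.1 hR).1
  rw [List.append_nil] at h_eq
  obtain ⟨P₂', hP', rfl⟩ := exists_append_eq_of_mem_right hnd h_eq hcY
  exact ⟨X₁, P₂', hP', rfl⟩

theorem rightLanguage_eq_preimage_reverse : rightLanguage A B P Q =
    List.reverse ⁻¹' leftLanguage B.reverse A.reverse Q.reverse P.reverse := by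
  ext u
  constructor
  · rintro ⟨Q₁, Q₂, rfl, rfl⟩
    exact ⟨Q₂.reverse, Q₁.reverse, by simp, by simp [reverse_sandwich]⟩
  · rintro ⟨P₁, P₂, hP, hu⟩
    exact ⟨P₂.reverse, P₁.reverse, by simpa using congrArg List.reverse hP,
      by simpa [reverse_sandwich] using congrArg List.reverse hu⟩

theorem isClosedUnderIdentitiesOf_rightLanguage (hw : HasPatterns w)
    (hB : BlockBalanced A B (d :: J ++ [c] ++ Q)) (hZ : IsAlternating A B (d :: J ++ [c] ++ Q))
    (hc : IsMarker w A B (d :: J ++ [c] ++ Q) Q c)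
    (hd : IsMarker w A B (d :: J ++ [c] ++ Q) Q d) :
    IsClosedUnderIdentitiesOf w (rightLanguage A B (d :: J ++ [c]) Q) := by
  have h_reverse : (d :: J ++ [c] ++ Q).reverse = Q.reverse ++ c :: (J.reverse ++ [d]) := by simp
  have h := isClosedUnderIdentitiesOf_leftLanguage hw.reverse (h_reverse ▸ hB.reverse)
    (h_reverse ▸ hZ.reverse) (h_reverse ▸ hc.reverse) (h_reverse ▸ hd.reverse)
  simpa [rightLanguage_eq_preimage_reverse] using h.reverse

theorem isSyntacticIdentityOf_rightLanguage {S : List ℕ} {c₀ e₁ c₂ e₂ c₁ : ℕ}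
    (hB : BlockBalanced A B (S ++ [c₁, e₂, c₂, e₁, c₀]))
    (hr : IsRigidStart B.reverse A.reverse c₀ e₁ c₂ e₂ c₁) :
    IsSyntacticIdentityOf (rightLanguage A B (S ++ [c₁, e₂, c₂]) [e₁, c₀])
      (sandwich A B [] (S ++ [c₁, e₂, c₂, e₁, c₀]) [])
      (sandwich A B [] (S ++ [c₁, e₂, c₂]) [e₁, c₀]) := by
  have h := isSyntacticIdentityOf_leftLanguage (T := S.reverse) (by simpa using hB.reverse) hr
  simpa [rightLanguage_eq_preimage_reverse, reverse_sandwich] using h.reverse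

theorem leftLanguage_inter_rightLanguage (h : P ++ Q = Z) (h' : P' ++ Q' = Z) :
    leftLanguage A B P Q ∩ rightLanguage A B P' Q' = {sandwich A B [] Z []} := by
  refine Set.Subset.antisymm ?_ (Set.singleton_subset_iff.2
    ⟨⟨[], P, rfl, by rw [h]⟩, ⟨Q', [], List.append_nil _, by rw [h']⟩⟩)
  rintro _ ⟨⟨P₁, P₂, rfl, rfl⟩, ⟨Q₁, Q₂, -, h_eq⟩⟩
  obtain rfl : P₁ = [] := by
    rcases P₁ with _ | ⟨i, P₁⟩
    · rfl
    · simp [sandwich_eq] at h_eq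
  rw [← h]
  rfl

theorem sandwich_ne_x_x_frame (hB : BlockBalanced A B (c :: Z)) :
    sandwich A B [] (c :: Z) [] ≠ Letter.x :: Letter.x :: frame A B (zWord (c :: Z)) := by
  rcases A with _ | ⟨i, A⟩ <;> simp [sandwich_eq]

open MonoidVariety in
theorem not_isDistributiveLattice_of_sandwich {M : List ℕ} {a₀ d₁ a₂ d₂ a₁ c₁ e₂ c₂ e₁ c₀ : ℕ}
    (hw : HasPatterns w) (hZ : Z = [a₀, d₁, a₂, d₂, a₁] ++ M ++ [c₁, e₂, c₂, e₁, c₀])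
    (h_balanced : BlockBalanced A B Z) (h_alternating : IsAlternating A B Z)
    (ha : IsRigidStart A B a₀ d₁ a₂ d₂ a₁) (hc : IsRigidStart B.reverse A.reverse c₀ e₁ c₂ e₂ c₁)
    (ha₂ : IsMarker w A B Z [a₀, d₁] a₂) (hc₀ : IsMarker w A B Z [a₀, d₁] c₀)
    (hc₂ : IsMarker w A B Z [e₁, c₀] c₂) (ha₀ : IsMarker w A B Z [e₁, c₀] a₀) :
    ¬ IsDistributiveLattice (SubvarietyLattice (ofFactors w)) := by
  have hZ₁ : Z = [a₀, d₁] ++ a₂ :: ((d₂ :: a₁ :: M ++ [c₁, e₂, c₂, e₁]) ++ [c₀]) := by simp [hZ]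
  have hZ₂ : Z = (a₀ :: (d₁ :: a₂ :: d₂ :: a₁ :: M ++ [c₁, e₂]) ++ [c₂]) ++ [e₁, c₀] := by
    simp [hZ]
  have hZ₃ : Z = a₀ :: d₁ :: a₂ :: d₂ :: a₁ :: (M ++ [c₁, e₂, c₂, e₁, c₀]) := by simp [hZ]
  refine not_isDistributiveLattice_of_languages (leftLanguage_inter_rightLanguage hZ₁.symm hZ₂.symm)
    (isClosedUnderIdentitiesOf_leftLanguage hw (hZ₁ ▸ h_balanced) (hZ₁ ▸ h_alternating)
      (hZ₁ ▸ ha₂) (hZ₁ ▸ hc₀))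
    (isClosedUnderIdentitiesOf_rightLanguage hw (hZ₂ ▸ h_balanced) (hZ₂ ▸ h_alternating)
      (hZ₂ ▸ hc₂) (hZ₂ ▸ ha₀))
    (g := sandwich A B [a₀, d₁] (a₂ :: d₂ :: a₁ :: (M ++ [c₁, e₂, c₂, e₁, c₀])) [])
    (h := sandwich A B [] ([a₀, d₁, a₂, d₂, a₁] ++ M ++ [c₁, e₂, c₂]) [e₁, c₀])
    (f₀ := Letter.x :: Letter.x :: frame A B (zWord Z)) ?_ ?_ ?_ ?_ ?_
  · simpa [hZ] using isSyntacticIdentityOf_leftLanguage (hZ₃ ▸ h_balanced) ha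
  · simpa only [hZ, List.cons_append, List.nil_append, List.append_assoc] using
      isSyntacticIdentityOf_rightLanguage (S := [a₀, d₁, a₂, d₂, a₁] ++ M) (hZ ▸ h_balanced) hc
  · have h_eq : Z = [a₀, d₁] ++ a₂ :: d₂ :: a₁ :: (M ++ [c₁, e₂, c₂, e₁, c₀]) ++ [] := by simp [hZ]
    exact h_eq ▸ isIdentityOf_of_shorter (h_eq ▸ h_balanced) (by simp)
  · have h_eq : Z = [] ++ ([a₀, d₁, a₂, d₂, a₁] ++ M ++ [c₁, e₂, c₂]) ++ [e₁, c₀] := by simp [hZ]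
    exact h_eq ▸ isIdentityOf_of_shorter (h_eq ▸ h_balanced) (by simp)
  · exact hZ₃ ▸ sandwich_ne_x_x_frame (hZ₃ ▸ h_balanced)

end Languages

section SandwichPatterns

variable {A B Z : List ℕ}

theorem IsAlternating.eq_singleton_of_left_eq_nil (hB : BlockBalanced [] B Z)
    (hZ : IsAlternating [] B Z) (hZn : Z ≠ []) : ∃ b, Z = [b] ∧ B = [b] := by
  rcases Z with _ | ⟨b, _ | ⟨c, Z⟩⟩
  · exact absurd rfl hZn
  · exact ⟨b, rfl, by simpa [eq_comm] using hB.perm⟩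
  · simpa using (List.isChain_cons_cons.1 hZ).1

theorem exists_before_isInfix_sandwich (hB : BlockBalanced A B Z) (hZ : IsAlternating A B Z)
    (hZn : Z ≠ []) : ∃ (c y : Letter) (s : List Letter), c ≠ y ∧
      [c, y] ++ s ++ [y] <:+: sandwich A B [] Z [] := by
  rcases List.eq_nil_or_concat A with rfl | ⟨A, i, rfl⟩
  · obtain ⟨b, rfl, rfl⟩ := hZ.eq_singleton_of_left_eq_nil hB hZn
    exact ⟨Letter.x, Letter.z b, [Letter.x, Letter.t b], by simp, [], [], by simp [sandwich_eq]⟩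
  · exact ⟨Letter.t i, Letter.x, zWord Z, by simp, ztWord A ++ [Letter.z i], tzWord B,
      by simp [sandwich_eq]⟩

theorem exists_after_isInfix_sandwich (hB : BlockBalanced A B Z) (hZ : IsAlternating A B Z)
    (hZn : Z ≠ []) : ∃ (c y : Letter) (s : List Letter), c ≠ y ∧
      [y] ++ s ++ [y, c] <:+: sandwich A B [] Z [] := by
  obtain ⟨c, y, s, hcy, h⟩ :=
    exists_before_isInfix_sandwich hB.reverse hZ.reverse (List.reverse_ne_nil_iff.2 hZn)
  refine ⟨c, y, s.reverse, hcy, List.reverse_infix.1 ?_⟩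
  simpa [reverse_sandwich] using h

theorem exists_crossing_isInfix_sandwich (hB : BlockBalanced A B Z) (hZ : IsAlternating A B Z)
    (hZn : Z ≠ []) : ∃ (y y' : Letter) (r s : List Letter), y ≠ y' ∧
      [y] ++ r ++ [y', y] ++ s ++ [y'] <:+: sandwich A B [] Z [] := by
  obtain ⟨i, Z, rfl⟩ := List.exists_cons_of_ne_nil hZn
  rcases hB.mem_iff.1 List.mem_cons_self with hi | hi
  · obtain ⟨A₁, A₂, rfl⟩ := List.append_of_mem hi
    exact ⟨Letter.z i, Letter.x, Letter.t i :: ztWord A₂, zWord Z, by simp, ztWord A₁, tzWord B,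
      by simp [sandwich_eq]⟩
  rcases Z with _ | ⟨j, Z⟩
  · obtain ⟨rfl, rfl⟩ : A = [] ∧ B = [i] :=
      (List.append_eq_singleton_iff.1 (List.singleton_perm.1 hB.perm).symm).resolve_right
        fun h => by simp [h.2] at hi
    exact ⟨Letter.x, Letter.z i, [], [Letter.t i], by simp, [], [], by simp [sandwich_eq]⟩
  · have hj : j ∈ A := by
      rcases (List.isChain_cons_cons.1 hZ).1 with h | h
      · exact absurd hi (hB.disjoint h.1)
      · exact h.2
    have hij : i ≠ j := fun hij => hB.disjoint hj (hij ▸ hi)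
    obtain ⟨A₁, A₂, rfl⟩ := List.append_of_mem hj
    obtain ⟨B₁, B₂, rfl⟩ := List.append_of_mem hi
    exact ⟨Letter.z j, Letter.z i, Letter.t j :: ztWord A₂ ++ [Letter.x],
      zWord Z ++ [Letter.x] ++ tzWord B₁ ++ [Letter.t i], by simp [hij.symm], ztWord A₁,
      tzWord B₂, by simp [sandwich_eq]⟩

theorem hasPatterns_sandwich (hB : BlockBalanced A B Z) (hZ : IsAlternating A B Z)
    (hZn : Z ≠ []) : HasPatterns (sandwich A B [] Z []) where
  enclosed := by
    refine ⟨Letter.x, zWord Z, x_notMem_zWord, ?_, ztWord A, tzWord B, by simp [sandwich_eq]⟩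
    exact List.map_eq_nil_iff.not.2 hZn
  before := exists_before_isInfix_sandwich hB hZ hZn
  after := exists_after_isInfix_sandwich hB hZ hZn
  crossing := exists_crossing_isInfix_sandwich hB hZ hZn

end SandwichPatterns

/-! ### Enlarging a frame -/

/-- The erasing substitution that keeps exactly the letters of `Z`. -/
def keep (Z : List ℕ) (i : ℕ) : Option ℕ := if i ∈ Z then some i else none

/-- The erasing substitution that puts `y` in the place of the letter `s` of `Z`, keeps the other
letters of `Z` and erases everything else. -/
def transfer (Z : List ℕ) (y s i : ℕ) : Option ℕ :=
  if i = y then some s else if i ∈ Z ∧ i ≠ s then some i else none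

/-- The erasing substitution `σ` maps the letters of the two sides of a frame and of its main block
to the given lists. -/
structure Collapses (σ : ℕ → Option ℕ) (A' B' Z' A B Z : List ℕ) : Prop where
  left : A'.filterMap σ = A
  right : B'.filterMap σ = B
  block : Z'.filterMap σ = Z

/-- The frame `A'`, `B'` arises from `A`, `B` by adding new letters that precede the main block `Z`.
The enlarged frame has a rigid start, and each of the new letters `a₀` and `a₂` can play the
role of the letter `s` of `Z` in a copy of the original frame. -/
structure IsRigidExtension (A B Z A' B' : List ℕ) (s a₀ d₁ a₂ d₂ a₁ f : ℕ) : Prop where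
  balanced : BlockBalanced A' B' ([a₀, d₁, a₂, d₂, a₁, f] ++ Z)
  alternating : IsAlternating A' B' ([a₀, d₁, a₂, d₂, a₁, f] ++ Z)
  rigid : IsRigidStart A' B' a₀ d₁ a₂ d₂ a₁
  collapses_keep : Collapses (keep Z) A' B' ([a₀, d₁, a₂, d₂, a₁, f] ++ Z) A B Z
  collapses_transfer : ∀ y ∈ [a₀, a₂],
    Collapses (transfer Z y s) A' B' ([a₀, d₁, a₂, d₂, a₁, f] ++ Z) A B Z

section Collapse

variable {A B Z A' B' Z' L N N' : List ℕ} {w : List Letter} {i s y : ℕ} {σ : ℕ → Option ℕ}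

theorem filterMap_keep_append {L₁ L₂ : List ℕ} (h₁ : L₁ ⊆ Z) (h : ∀ i ∈ L, i ∉ Z)
    (h₂ : L₂ ⊆ Z) : (L₁ ++ (L ++ L₂)).filterMap (keep Z) = L₁ ++ L₂ := by
  have h_self {M : List ℕ} (hM : M ⊆ Z) : M.filterMap (keep Z) = M := by
    rw [List.filterMap_congr (g := some) fun i hi => ?_, List.filterMap_some]
    rw [keep, if_pos (hM hi)]
  rw [List.filterMap_append, List.filterMap_append, h_self h₁, h_self h₂,
    List.filterMap_eq_nil_iff.2 fun i hi => by rw [keep, if_neg (h i hi)], List.nil_append]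

theorem filterMap_keep_sublist : (L.filterMap (keep Z)).Sublist L := by
  induction L with
  | nil => exact List.Sublist.refl _
  | cons i L ih =>
    rw [List.filterMap_cons, keep]
    split_ifs
    exacts [ih.cons_cons i, ih.cons i]

theorem keep_eq_some_iff (hs : s ∈ Z) : keep Z i = some s ↔ i = s := by
  grind [keep]

theorem transfer_eq_some_iff : transfer Z y s i = some s ↔ i = y := by
  grind [transfer]

theorem filterMap_transfer_eq_self (h : L ⊆ Z) (hs : s ∉ L) (hy : y ∉ Z) :
    L.filterMap (transfer Z y s) = L := by
  rw [List.filterMap_congr (g := some) fun i hi => ?_, List.filterMap_some]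
  rw [transfer, if_neg (ne_of_mem_of_not_mem (h hi) hy),
    if_pos ⟨h hi, ne_of_mem_of_not_mem hi hs⟩]

theorem filterMap_transfer_eq_nil (h : ∀ i ∈ L, i ≠ y ∧ (i ∈ Z → i = s)) :
    L.filterMap (transfer Z y s) = [] :=
  List.filterMap_eq_nil_iff.2 fun i hi => by
    rw [transfer, if_neg (h i hi).1, if_neg fun h' => h'.2 ((h i hi).2 h'.1)]

theorem filterMap_transfer_append {L₁ L₂ : List ℕ} (h₁ : L₁ ⊆ Z) (h : ∀ i ∈ L, i ∉ Z)
    (h₂ : L₂ ⊆ Z) (hs : s ∈ Z) (hs₁ : s ∉ L₁) (hs₂ : s ∉ L₂) (hL : L.Nodup) (hy : y ∈ L) :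
    (L₁ ++ (L ++ s :: L₂)).filterMap (transfer Z y s) = L₁ ++ s :: L₂ := by
  have hyZ : y ∉ Z := h y hy
  obtain ⟨M₁, M₂, rfl⟩ := List.append_of_mem hy
  have hM₁ : M₁.filterMap (transfer Z y s) = [] := filterMap_transfer_eq_nil (by grind)
  have hM₂ : (M₂ ++ [s]).filterMap (transfer Z y s) = [] := filterMap_transfer_eq_nil (by grind)
  rw [show M₁ ++ y :: M₂ ++ s :: L₂ = M₁ ++ (y :: (M₂ ++ [s]) ++ L₂) by simp,
    List.filterMap_append, List.filterMap_append, List.filterMap_append,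
    List.filterMap_cons_some (transfer_eq_some_iff.2 rfl), hM₁, hM₂,
    filterMap_transfer_eq_self h₁ hs₁ hyZ, filterMap_transfer_eq_self h₂ hs₂ hyZ]
  rfl

theorem isMarker_sandwich (A B Z : List ℕ) (i : ℕ) :
    IsMarker (sandwich A B [] Z []) A B Z [] i :=
  ⟨some, ⟨i, fun _ => Option.some_inj⟩, by simp, by simp only [List.filterMap_some]⟩

theorem IsMarker.of_collapses (h : IsMarker w A B Z N s) (hσ : Collapses σ A' B' Z' A B Z)
    (hi : ∀ k, σ k = some s ↔ k = i) (hN : ∀ k ∈ N', ∀ j, σ k = some j → j ∈ N) :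
    IsMarker w A' B' Z' N' i := by
  obtain ⟨π, ⟨j, hj⟩, hπ, hw⟩ := h
  refine ⟨fun k => (σ k).bind π, ⟨j, fun k => ?_⟩, fun k hk => ?_, ?_⟩
  · simp only [Option.bind_eq_some_iff, hj, exists_eq_right, hi]
  · rw [Option.bind_eq_none_iff]
    exact fun j hj => hπ j (hN k hk j hj)
  · rw [← hw, ← hσ.left, ← hσ.right, ← hσ.block]
    simp only [List.filterMap_filterMap]

end Collapse

section Extension

variable {A B Z A' B' Z' N N' : List ℕ} {w : List Letter} {i s y a₀ d₁ a₂ d₂ a₁ f : ℕ}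

theorem IsRigidStart.symm (h : IsRigidStart A B a₀ d₁ a₂ d₂ a₁) :
    IsRigidStart B A a₀ d₁ a₂ d₂ a₁ :=
  Or.symm h

theorem IsRigidStart.mono (h : IsRigidStart A B a₀ d₁ a₂ d₂ a₁) (hA : A.Sublist A')
    (hB : B.Sublist B') : IsRigidStart A' B' a₀ d₁ a₂ d₂ a₁ :=
  h.imp (fun h => ⟨h.1.trans hA, hB.subset h.2.1, hB.subset h.2.2⟩)
    fun h => ⟨h.1.trans hB, hA.subset h.2.1, hA.subset h.2.2⟩

theorem BlockBalanced.symm (h : BlockBalanced A B Z) : BlockBalanced B A Z :=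
  ⟨h.nodup, h.perm.trans List.perm_append_comm⟩

theorem IsAlternating.symm (h : IsAlternating A B Z) : IsAlternating B A Z :=
  h.imp fun _ _ => Or.symm

theorem IsAlternating.mono (h : IsAlternating A B Z) (hA : A ⊆ A') (hB : B ⊆ B') :
    IsAlternating A' B' Z :=
  h.imp fun _ _ => Or.imp (And.imp (@hA _) (@hB _)) (And.imp (@hB _) (@hA _))

theorem Collapses.symm {σ : ℕ → Option ℕ} (h : Collapses σ A' B' Z' A B Z) :
    Collapses σ B' A' Z' B A Z :=
  ⟨h.right, h.left, h.block⟩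

namespace IsRigidExtension

theorem symm (h : IsRigidExtension A B Z A' B' s a₀ d₁ a₂ d₂ a₁ f) :
    IsRigidExtension B A Z B' A' s a₀ d₁ a₂ d₂ a₁ f :=
  ⟨h.balanced.symm, h.alternating.symm, h.rigid.symm, h.collapses_keep.symm,
    fun y hy => (h.collapses_transfer y hy).symm⟩

theorem sublist_left (h : IsRigidExtension A B Z A' B' s a₀ d₁ a₂ d₂ a₁ f) : A.Sublist A' :=
  h.collapses_keep.left ▸ filterMap_keep_sublist

theorem sublist_right (h : IsRigidExtension A B Z A' B' s a₀ d₁ a₂ d₂ a₁ f) : B.Sublist B' :=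
  h.symm.sublist_left

theorem isMarker_of_mem (h : IsRigidExtension A B Z A' B' s a₀ d₁ a₂ d₂ a₁ f)
    (hw : IsMarker w A B Z N i) (hi : i ∈ Z) (hN : ∀ j ∈ N', j ∈ Z → j ∈ N) :
    IsMarker w A' B' ([a₀, d₁, a₂, d₂, a₁, f] ++ Z) N' i :=
  hw.of_collapses h.collapses_keep (fun _ => keep_eq_some_iff hi) fun k hk j hj => by grind [keep]

theorem isMarker_of_transfer (h : IsRigidExtension A B Z A' B' s a₀ d₁ a₂ d₂ a₁ f)
    (hw : IsMarker w A B Z N s) (hy : y ∈ [a₀, a₂]) (hN : ∀ j ∈ N', j ≠ y ∧ (j ∈ Z → j ∈ N)) :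
    IsMarker w A' B' ([a₀, d₁, a₂, d₂, a₁, f] ++ Z) N' y :=
  hw.of_collapses (h.collapses_transfer y hy) (fun _ => transfer_eq_some_iff) fun k hk j hj => by
    grind [transfer]

end IsRigidExtension

section Insert

variable {A₁ A₂ V X Y : List ℕ}

theorem collapses_keep_append (hB : BlockBalanced (A₁ ++ A₂) B Z) (hX : ∀ i ∈ X, i ∉ Z)
    (hY : ∀ i ∈ Y, i ∉ Z) (hV : ∀ i ∈ V, i ∉ Z) :
    Collapses (keep Z) (A₁ ++ (X ++ A₂)) (Y ++ B) (V ++ Z) (A₁ ++ A₂) B Z where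
  left := filterMap_keep_append (fun i hi => hB.mem_iff.2 (by simp [hi])) hX
    fun i hi => hB.mem_iff.2 (by simp [hi])
  right := filterMap_keep_append (List.nil_subset _) hY fun i hi => hB.mem_iff.2 (Or.inr hi)
  block := filterMap_keep_append (List.nil_subset _) hV (List.Subset.refl _)

theorem collapses_transfer_append (hB : BlockBalanced (A₁ ++ s :: A₂) B (s :: Z))
    (hX : ∀ i ∈ X, i ∉ s :: Z) (hY : ∀ i ∈ Y, i ∉ s :: Z) (hV : ∀ i ∈ V, i ∉ s :: Z)
    (hXn : X.Nodup) (hVn : V.Nodup) (hyX : y ∈ X) (hyY : y ∉ Y) (hyV : y ∈ V) :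
    Collapses (transfer (s :: Z) y s) (A₁ ++ (X ++ s :: A₂)) (Y ++ B) (V ++ s :: Z)
      (A₁ ++ s :: A₂) B (s :: Z) where
  left := by
    have hA : A₁ ++ s :: A₂ ⊆ s :: Z := fun i hi => hB.mem_iff.2 (Or.inl hi)
    have hn := hB.nodup_left
    exact filterMap_transfer_append (by grind) hX (by grind) List.mem_cons_self (by grind)
      (by grind) hXn hyX
  right := by
    have hsB : s ∉ B := fun hs => hB.disjoint (by simp) hs
    rw [List.filterMap_append, filterMap_transfer_eq_nil (by grind), filterMap_transfer_eq_self
      (fun i hi => hB.mem_iff.2 (Or.inr hi)) hsB (hX y hyX), List.nil_append]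
  block := filterMap_transfer_append (List.nil_subset _) hV (List.subset_cons_self _ _)
    List.mem_cons_self List.not_mem_nil (List.nodup_cons.1 hB.nodup).1 hVn hyV

theorem isRigidExtension_of_forall_lt {k : ℕ} (hB : BlockBalanced (A₁ ++ s :: A₂) B (s :: Z))
    (hZ : IsAlternating (A₁ ++ s :: A₂) B (s :: Z)) (hk : ∀ i ∈ s :: Z, i < k) :
    IsRigidExtension (A₁ ++ s :: A₂) B (s :: Z) (A₁ ++ ([k, k + 1, k + 2] ++ s :: A₂))
      ([k + 3, k + 4, k + 5] ++ B) s k (k + 3) (k + 2) (k + 4) (k + 1) (k + 5) := by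
  have h_new {L : List ℕ} (hL : ∀ i ∈ L, k ≤ i) : ∀ i ∈ L, i ∉ s :: Z :=
    fun i hi h => (hk i h).not_ge (hL i hi)
  refine ⟨⟨?_, List.perm_iff_count.2 fun i => ?_⟩, ?_, ?_, ?_, fun y hy => ?_⟩
  · exact List.Nodup.append (by simp) hB.nodup fun i hi => h_new (by simp) i hi
  · have h_count := hB.perm.count_eq i
    simp only [List.count_append, List.count_cons, List.count_nil] at h_count ⊢
    omega
  · have h_mono : IsAlternating (A₁ ++ ([k, k + 1, k + 2] ++ s :: A₂)) ([k + 3, k + 4, k + 5] ++ B)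
        (s :: Z) := hZ.mono (by grind) (by grind)
    simpa [IsAlternating] using h_mono
  · exact Or.inl ⟨(List.sublist_append_left [k, k + 1, k + 2] (s :: A₂)).trans
      (List.sublist_append_right _ _), by simp, by simp⟩
  · exact collapses_keep_append hB (h_new (by simp)) (h_new (by simp)) (h_new (by simp))
  · obtain rfl | rfl : y = k ∨ y = k + 2 := by simpa using hy
    all_goals
      exact collapses_transfer_append hB (h_new (by simp)) (h_new (by simp)) (h_new (by simp))
        (by simp) (by simp) (by simp) (by simp) (by simp)

end Insert

theorem exists_isRigidExtension (hB : BlockBalanced A B Z) (hZ : IsAlternating A B Z)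
    (hs : Z.head? = some s) :
    ∃ A' B' a₀ d₁ a₂ d₂ a₁ f, IsRigidExtension A B Z A' B' s a₀ d₁ a₂ d₂ a₁ f := by
  obtain ⟨Z, rfl⟩ := List.head?_eq_some_iff.1 hs
  wlog hsA : s ∈ A generalizing A B
  · obtain ⟨B', A', a₀, d₁, a₂, d₂, a₁, f, h⟩ :=
      this hB.symm hZ.symm ((hB.mem_iff.1 List.mem_cons_self).resolve_left hsA)
    exact ⟨A', B', a₀, d₁, a₂, d₂, a₁, f, h.symm⟩
  obtain ⟨A₁, A₂, rfl⟩ := List.append_of_mem hsA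
  exact ⟨_, _, _, _, _, _, _, _, isRigidExtension_of_forall_lt hB hZ
    (k := (s :: Z).sum + 1) fun i hi => Nat.lt_succ_of_le (List.le_sum_of_mem hi)⟩

end Extension

section TwoSided

variable {A B Z A₁ B₁ A₂ B₂ N : List ℕ} {w : List Letter}
  {s a₀ d₁ a₂ d₂ a₁ f l c₀ e₁ c₂ e₂ c₁ f' y : ℕ}
  (h₁ : IsRigidExtension A B Z A₁ B₁ s a₀ d₁ a₂ d₂ a₁ f)
  (h₂ : IsRigidExtension B₁.reverse A₁.reverse ([a₀, d₁, a₂, d₂, a₁, f] ++ Z).reverse B₂ A₂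
    l c₀ e₁ c₂ e₂ c₁ f')

include h₁ h₂

theorem isMarker_start (hw : IsMarker w A B Z [] s) (hy : y ∈ [a₀, a₂])
    (hN : ∀ j ∈ N, j ≠ y ∧ j ∉ Z) :
    IsMarker w A₂.reverse B₂.reverse
      ([a₀, d₁, a₂, d₂, a₁, f] ++ Z ++ [f', c₁, e₂, c₂, e₁, c₀]) N y := by
  have h_left : IsMarker w A₁ B₁ ([a₀, d₁, a₂, d₂, a₁, f] ++ Z) N y :=
    h₁.isMarker_of_transfer hw hy fun j hj => ⟨(hN j hj).1, fun h => absurd h (hN j hj).2⟩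
  have h_right := h₂.isMarker_of_mem (N' := N.reverse) h_left.reverse (by grind) (by grind)
  simpa using h_right.reverse

theorem isMarker_end (hw : IsMarker w A B Z [] l) (hl : l ∈ Z) (hy : y ∈ [c₀, c₂])
    (hN : ∀ j ∈ N, j ≠ y ∧ j ∉ Z) :
    IsMarker w A₂.reverse B₂.reverse
      ([a₀, d₁, a₂, d₂, a₁, f] ++ Z ++ [f', c₁, e₂, c₂, e₁, c₀]) N y := by
  have h_left : IsMarker w A₁ B₁ ([a₀, d₁, a₂, d₂, a₁, f] ++ Z) N l :=
    h₁.isMarker_of_mem hw hl fun j hj h => absurd h (hN j hj).2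
  have h_right := h₂.isMarker_of_transfer (N' := N.reverse) h_left.reverse hy (by grind)
  simpa using h_right.reverse

end TwoSided

open MonoidVariety in
theorem not_isDistributiveLattice_of_isAlternating {A B Z : List ℕ} (hB : BlockBalanced A B Z)
    (hZ : IsAlternating A B Z) (hZn : Z ≠ []) :
    ¬ IsDistributiveLattice (SubvarietyLattice (ofFactors (sandwich A B [] Z []))) := by
  obtain ⟨s, hs⟩ : ∃ s, Z.head? = some s := ⟨_, List.head?_eq_some_head hZn⟩
  obtain ⟨l, hl⟩ : ∃ l, Z.getLast? = some l := ⟨_, List.getLast?_eq_some_getLast hZn⟩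
  have hlZ : l ∈ Z := List.mem_of_getLast? hl
  obtain ⟨A₁, B₁, a₀, d₁, a₂, d₂, a₁, f, h₁⟩ := exists_isRigidExtension hB hZ hs
  obtain ⟨B₂, A₂, c₀, e₁, c₂, e₂, c₁, f', h₂⟩ :=
    exists_isRigidExtension (s := l) h₁.balanced.reverse h₁.alternating.reverse (by simp [hl])
  have h_balanced : BlockBalanced A₂.reverse B₂.reverse
      ([a₀, d₁, a₂, d₂, a₁, f] ++ Z ++ [f', c₁, e₂, c₂, e₁, c₀]) := by
    simpa using h₂.balanced.reverse
  have h_nodup := h_balanced.nodup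
  simp only [List.cons_append, List.nil_append, List.nodup_cons, List.nodup_append,
    List.mem_cons, List.mem_append, not_or] at h_nodup
  have h_sublist_left : A₁.Sublist A₂.reverse := by simpa using h₂.sublist_right.reverse
  have h_sublist_right : B₁.Sublist B₂.reverse := by simpa using h₂.sublist_left.reverse
  have h_marker := isMarker_sandwich A B Z
  exact not_isDistributiveLattice_of_sandwich (hasPatterns_sandwich hB hZ hZn)
    (Z := [a₀, d₁, a₂, d₂, a₁, f] ++ Z ++ [f', c₁, e₂, c₂, e₁, c₀]) (A := A₂.reverse)
    (B := B₂.reverse) (M := f :: Z ++ [f']) (c₁ := c₁) (e₂ := e₂) (c₂ := c₂) (e₁ := e₁) (c₀ := c₀)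
    (by simp) h_balanced (by simpa using h₂.alternating.reverse)
    (h₁.rigid.mono h_sublist_left h_sublist_right) (by simpa using h₂.rigid)
    (isMarker_start h₁ h₂ (h_marker s) (by simp) (by grind))
    (isMarker_end h₁ h₂ (h_marker l) hlZ (by simp) (by grind))
    (isMarker_end h₁ h₂ (h_marker l) hlZ (by simp) (by grind))
    (isMarker_start h₁ h₂ (h_marker s) (by simp) (by grind))

section Main

variable {n m : ℕ} {ρ : Equiv.Perm (Fin (n + m))}

theorem toList_aWord : (aWord n m ρ).toList =
    sandwich (List.range n) ((List.range m).map (n + ·)) [] (List.ofFn fun i => (ρ i : ℕ)) [] := by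
  have h_left : (List.ofFn fun i : Fin n =>
      FreeMonoid.of (Letter.z i) * FreeMonoid.of (Letter.t i)).prod.toList =
      ztWord (List.range n) := by
    rw [FreeMonoid.toList_prod, ztWord, List.flatMap_def, ← List.map_coe_finRange_eq_range,
      List.ofFn_eq_map, List.map_map, List.map_map]
    rfl
  have h_block : (List.ofFn fun i : Fin (n + m) => FreeMonoid.of (Letter.z (ρ i))).prod.toList =
      zWord (List.ofFn fun i => (ρ i : ℕ)) := by
    rw [FreeMonoid.toList_prod, zWord, List.ofFn_eq_map, List.ofFn_eq_map, List.map_map,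
      List.map_map, ← List.flatMap_def, List.map_eq_flatMap]
    rfl
  have h_right : (List.ofFn fun j : Fin m =>
      FreeMonoid.of (Letter.t (n + j)) * FreeMonoid.of (Letter.z (n + j))).prod.toList =
      tzWord ((List.range m).map (n + ·)) := by
    rw [FreeMonoid.toList_prod, tzWord, List.flatMap_def, ← List.map_coe_finRange_eq_range,
      List.ofFn_eq_map, List.map_map, List.map_map, List.map_map]
    rfl
  simp only [aWord, FreeMonoid.toList_mul, h_left, h_block, h_right, FreeMonoid.toList_of]
  simp [sandwich, frame, xBlock]

theorem blockBalanced_ofFn : BlockBalanced (List.range n) ((List.range m).map (n + ·))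
    (List.ofFn fun i => (ρ i : ℕ)) where
  nodup := List.nodup_ofFn.2 fun _ _ h => ρ.injective (Fin.ext h)
  perm := by
    rw [← List.range_add, ← List.map_coe_finRange_eq_range, ← List.ofFn_eq_map]
    exact Equiv.Perm.ofFn_comp_perm ρ fun i => (i : ℕ)

theorem IsNMPermutation.isAlternating (hρ : IsNMPermutation n m ρ) :
    IsAlternating (List.range n) ((List.range m).map (n + ·)) (List.ofFn fun i => (ρ i : ℕ)) := by
  have h_right {j : Fin (n + m)} (hj : n ≤ (j : ℕ)) : (j : ℕ) ∈ (List.range m).map (n + ·) :=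
    List.mem_map.2 ⟨j - n, List.mem_range.2 (by omega), by omega⟩
  rw [IsAlternating, List.isChain_ofFn]
  intro i hi
  exact (hρ ⟨i, by omega⟩ ⟨i + 1, hi⟩ rfl).imp
    (fun h => ⟨List.mem_range.2 h.1, h_right h.2⟩) fun h => ⟨h_right h.2, List.mem_range.2 h.1⟩

end Main

theorem mainTheorem3 (n m : ℕ) (hnm : |(n : ℤ) - (m : ℤ)| ≤ 1) (hpos : 1 ≤ n + m)
    (ρ : Equiv.Perm (Fin (n + m))) (hρ : IsNMPermutation n m ρ) :
    ¬ IsDistributiveLattice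
        (MonoidVariety.SubvarietyLattice
          (MonoidVariety.generatedBy (MonCat.of (FactorMonoid {aWord n m ρ})))) := by
  have h_nonempty : (List.ofFn fun i => (ρ i : ℕ)) ≠ [] := mt List.ofFn_eq_nil_iff.1 (by omega)
  have h_main := not_isDistributiveLattice_of_isAlternating blockBalanced_ofFn hρ.isAlternating
    h_nonempty
  rwa [← toList_aWord] at h_main
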